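/- All graphs are finite, simple and undirected; connected graphs (in particular trees) are nonempty. For $U \subseteq V(G)$ let $N_G(U) = \bigcup_{u\in U} N_G(u) \setminus U$. A separation of order $k$ of a graph $G$ is a pair $(A,B)$ of subgraphs of $G$ with $A\cup B = G$, $E(A \cap B)=\emptyset$ and $|V(A)\cap V(B)| = k$. The rooted $2$-treedepth $\operatorname{rtd}_2(G)$ is defined recursively: it is $0$ for the null graph, $1$ for a one-vertex graph, and otherwise the minimum of $\max\{\operatorname{rtd}_2(A), \operatorname{rtd}_2(B - V(A)) + |V(A)\cap V(B)|\}$ over all separations $(A,B)$ of $G$ of order at most one with $V(A)\neq\emptyset$ and $V(B)\setminus V(A)\neq\emptyset$. For a family $\mathcal{F}$ of connected subgraphs of $G$, an $\mathcal{F}$-rich model of a graph $X$ in $G$ is a family $(B_x \mid x\in V(X))$ of pairwise disjoint subsets of $V(G)$ such that $G[B_x]$ is connected for every $x \in V(X)$, there is an edge of $G$ between $B_x$ and $B_y$ for every $xy\in E(X)$, and for every $x\in V(X)$ there is $F\in\mathcal{F}$ with $F\subseteq G[B_x]$. For $S\subseteq V(G)$, an ordering $\sigma$ of $S$, an integer $r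 \geq 0$ and $u\in V(G)$, let $\mathrm{WReach}_r[G,S,\sigma,u]$ be the set of all $v\in S$ for which there is a $u$-$v$ path $P$ in $G$ with at most $r$ edges such that $v = \min_\sigma (V(P)\cap S)$. Let $\operatorname{wcol}_r(G,S) = \min_\sigma \max_{u\in V(G)} |\mathrm{WReach}_r[G,S,\sigma,u]|$, where the minimum is over all orderings $\sigma$ of $S$ (and the maximum is $0$ if $G$ is null). **Theorem.** Let $t\geq 2$ be an integer and let $X$ be a graph with $\operatorname{rtd}_2(X)\leq t$. There exists an integer $\bar c(t,X)$ such that for every integer $k$, for every graph $G$ with treewidth $\operatorname{tw}(G)<k$, and for every family $\mathcal{F}$ of connected subgraphs of $G$, if $G$ has no $\mathcal{F}$-rich model of $X$, then there exists $S\subseteq V(G)$ such that 1. $V(F)\cap S\neq\emptyset$ for every $F\in\mathcal{F}$; 2. for every component $C$ of $G-S$, $N_G(V(C))$ intersects at most two components of $G-V(C)$; 3. $\operatorname{wcol}_r(G,S)\leq \bar c(t,X)\cdot k\cdot r^{t-2}\log r$ for every integer $r\geq 2$. -/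

import Mathlib

namespace WeakColoring

/-- `(A, B)` is a separation of order `k` of the graph `H`
(all of them given as subgraphs of an ambient graph `G`). -/
structure IsSeparation {V : Type*} {G : SimpleGraph V} (H A B : G.Subgraph) (k : ℕ) : Prop where
  union_eq : A ⊔ B = H
  edge_disjoint : (A ⊓ B).edgeSet = ∅
  order_eq : (A ⊓ B).verts.ncard = k

/-- Rooted `2`-treedepth of a subgraph `H` of a finite graph `G`, seen as a graph of its own.
If `H` has at least two vertices, it is the minimum of
`max (rtd₂ A) (rtd₂ (B - V(A)) + |V(A) ∩ V(B)|)` over the separations `(A, B)` of `H` of order at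
most one with `V(A)` and `V(B) \ V(A)` nonempty; `({v}, H)` is always one of them. -/
noncomputable def rtd₂Sub {V : Type*} [Finite V] {G : SimpleGraph V} (H : G.Subgraph) : ℕ :=
  if H.verts.ncard = 0 then 0
  else if H.verts.ncard = 1 then 1
  else sInf {n : ℕ | ∃ (A B : G.Subgraph) (k : ℕ)
      (_ : IsSeparation H A B k ∧ k ≤ 1 ∧ A.verts.Nonempty ∧ (B.verts \ A.verts).Nonempty),
      n = max (rtd₂Sub A) (rtd₂Sub (B.deleteVerts A.verts) + (A.verts ∩ B.verts).ncard)}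
termination_by H.verts.ncard
decreasing_by
  all_goals
    rename_i h
    obtain ⟨⟨rfl, -, -⟩, -, ⟨a, ha⟩, ⟨b, hb, hba⟩⟩ := h
    refine Set.ncard_lt_ncard ?_ (Set.toFinite _)
  · exact ⟨fun x hx => Or.inl hx, fun h => hba (h (Or.inr hb))⟩
  · exact ⟨fun x hx => Or.inr hx.1, fun h => (h (Or.inl ha)).2 ha⟩

/-- Rooted `2`-treedepth of a finite graph. -/
noncomputable def rtd₂ {V : Type*} [Finite V] (G : SimpleGraph V) : ℕ :=
  rtd₂Sub (⊤ : G.Subgraph)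

/-- A tree decomposition of `G` whose tree has vertex set `I`.
Recall that `IsTree` and `Connected` require nonempty vertex sets. -/
structure TreeDecomposition {V : Type*} (G : SimpleGraph V) (I : Type) where
  tree : SimpleGraph I
  isTree : tree.IsTree
  bag : I → Set V
  connected_bags : ∀ u : V, (tree.induce {x | u ∈ bag x}).Connected
  edge_in_bag : ∀ u v : V, G.Adj u v → ∃ x, u ∈ bag x ∧ v ∈ bag x

/-- The maximum size of a bag, minus one. -/
noncomputable def TreeDecomposition.width {V : Type*} {G : SimpleGraph V} {I : Type}
    (D : TreeDecomposition G I) : ℤ :=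
  ((⨆ x, (D.bag x).ncard : ℕ) : ℤ) - 1

/-- Treewidth of a finite graph: the minimum width of a tree decomposition over a finite tree.
The null graph has treewidth `-1`. -/
noncomputable def treewidth {V : Type*} [Finite V] (G : SimpleGraph V) : ℤ :=
  sInf {w : ℤ | ∃ (I : Type) (_ : Finite I) (D : TreeDecomposition G I), D.width = w}

/-- `B` is a model of `X` in `G`. -/
structure IsModel {W V : Type*} (X : SimpleGraph W) (G : SimpleGraph V) (B : W → Set V) :
    Prop where
  disjoint : ∀ x y, x ≠ y → Disjoint (B x) (B y)
  connected : ∀ x, (G.induce (B x)).Connected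
  edge : ∀ x y, X.Adj x y → ∃ u ∈ B x, ∃ v ∈ B y, G.Adj u v

/-- `B` is an `F`-rich model of `X` in `G`: every branch set induces a subgraph
that contains a member of `F`. -/
structure IsRichModel {W V : Type*} (X : SimpleGraph W) (G : SimpleGraph V)
    (F : Set G.Subgraph) (B : W → Set V) : Prop extends IsModel X G B where
  rich : ∀ x, ∃ H ∈ F, H ≤ (⊤ : G.Subgraph).induce (B x)

/-- The set of the vertices that are weakly `r`-reachable from `u` in `(G, S, σ)`, where `σ` is an
ordering of `S`: the `v ∈ S` such that some `u`-`v` path of length at most `r` has `v` as the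
`σ`-minimum of its vertices in `S`. -/
def WReach {V : Type*} (G : SimpleGraph V) (r : ℕ) (S : Set V) (σ : LinearOrder S) (u : V) :
    Set V :=
  {v | ∃ hv : v ∈ S, ∃ P : G.Walk u v, P.IsPath ∧ P.length ≤ r ∧
    ∀ w (hw : w ∈ S), w ∈ P.support → σ.le ⟨v, hv⟩ ⟨w, hw⟩}

/-- `wcol_r(G, S, σ)`, the maximum of `|WReach_r[G, S, σ, u]|` over the vertices `u` of `G`
(which is `0` for the null graph). -/
noncomputable def wcolOrd {V : Type*} [Finite V] (G : SimpleGraph V) (r : ℕ) (S : Set V)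
    (σ : LinearOrder S) : ℕ :=
  ⨆ u : V, (WReach G r S σ u).ncard

/-- `wcol_r(G, S)`, the minimum of `wcol_r(G, S, σ)` over the orderings `σ` of `S`. -/
noncomputable def wcol {V : Type*} [Finite V] (G : SimpleGraph V) (r : ℕ) (S : Set V) : ℕ :=
  ⨅ σ : LinearOrder S, wcolOrd G r S σ

/-- The neighborhood `N_G(K)` of a set `K` of vertices. -/
def nbhd {V : Type*} (G : SimpleGraph V) (K : Set V) : Set V :=
  (⋃ u ∈ K, G.neighborSet u) \ K

/-- The vertex set, in the ambient type, of a component of `G[K]`. -/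
def componentVerts {V : Type*} {G : SimpleGraph V} {K : Set V}
    (C : (G.induce K).ConnectedComponent) : Set V :=
  Subtype.val '' C.supp

/-- The set of the components of `G - K` that are intersected by `N_G(K)`. -/
def touchedComponents {V : Type*} (G : SimpleGraph V) (K : Set V) :
    Set (G.induce Kᶜ).ConnectedComponent :=
  {D | (nbhd G K ∩ componentVerts D).Nonempty}

end WeakColoring

/-! Treewidth enters only through the property `Helly`: pairwise intersecting connected sets have a
transversal of at most `k` vertices, because the bags met by a connected set span a subtree and
subtrees of a tree have the Helly property (`TreeDecomposition.helly`). So a configuration that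
cannot occur twice disjointly is destroyed by `k` vertices, and the problem moves to the remaining
components (`Solvable.of_intersecting`). Ranking the deleted vertices before those chosen later
makes the weak coloring numbers of nested steps add up, while different components do not interact
(`WC.compose`).

The condition on components is kept as an invariant: for a component `C` of what remains of a
connected `U`, the rest `U \ C` is covered by two preconnected hubs (`Hub`). Nesting steps adds up
hubs, and `Helly.exists_hub_two` reduces `m` hubs to two for `m ^ 3 * k` vertices.
`Helly.exists_transversal` even makes `U \ C` preconnected.

The induction follows `rtd₂`. Call a connected set rich if it contains a member of the family. If
`X` arises from `A` by attaching `Y` to a vertex, the case of `A` is applied to the connected sets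
containing many copies of `Y` joined to a hub: a model of `A` with such branch sets yields a rich
model of `X` (`Contains.attach`). It remains to solve the problem where copies of `Y` with a common
hub are excluded (`ApexHit`).

There are two sources of such solutions. If `Y` is edgeless, the excluded configuration is a star,
and `solvable_of_not_star` reduces to a linear chain of separating layers of size at most `k`;
ranking the layers by the ruler sequence costs `O(k log r)`. In general, `Hit.apexHit` passes from
`copies m Y` to the excluded apex: rich sets touching the outside are hit again and again, which
produces distance-like layers, of which a walk of length `r` can see only `r + 1`. This costs a
factor `r`. Hence `log r` for `t = 2` and one more factor `r` for each further unit of `t`. -/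

namespace WeakColoring

/-! ### Connected sets, components and partitions into connected sets -/

section Connectivity

variable {V : Type*} {G : SimpleGraph V}

/-- `G[U]` is connected or null: every cut of `U` is crossed by an edge. -/
def Pre (G : SimpleGraph V) (U : Set V) : Prop :=
  ∀ A : Set V, (∃ a ∈ U, a ∈ A) → (∃ b ∈ U, b ∉ A) → ∃ x ∈ U, ∃ y ∈ U, x ∈ A ∧ y ∉ A ∧ G.Adj x y

/-- `G[U]` is connected. -/
def Conn (G : SimpleGraph V) (U : Set V) : Prop := U.Nonempty ∧ Pre G U

/-- There is an edge between `A` and `B`. -/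
def Touch (G : SimpleGraph V) (A B : Set V) : Prop := ∃ x ∈ A, ∃ y ∈ B, G.Adj x y

/-- `C` is the vertex set of a component of `G[U]`. -/
structure IsComp (G : SimpleGraph V) (U C : Set V) : Prop where
  sub : C ⊆ U
  conn : Conn G C
  closed : ∀ x ∈ C, ∀ y ∈ U, G.Adj x y → y ∈ C

theorem Touch.symm {A B : Set V} (h : Touch G A B) : Touch G B A := by
  obtain ⟨x, hx, y, hy, h⟩ := h
  exact ⟨y, hy, x, hx, h.symm⟩

theorem Touch.mono {A B A' B' : Set V} (h : Touch G A B) (hA : A ⊆ A') (hB : B ⊆ B') :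
    Touch G A' B' := by
  obtain ⟨x, hx, y, hy, h⟩ := h
  exact ⟨x, hA hx, y, hB hy, h⟩

theorem pre_empty : Pre G ∅ := fun _ ⟨_, h, _⟩ => h.elim

theorem pre_singleton (a : V) : Pre G {a} := by
  rintro A ⟨x, rfl, hx⟩ ⟨y, rfl, hy⟩
  exact (hy hx).elim

/-- A family of preconnected sets, each meeting or touching a preconnected set `D`. -/
theorem Pre.union_iUnion {ι : Sort*} {D : Set V} (hD : Pre G D) (K : ι → Set V)
    (hK : ∀ i, Pre G (K i)) (hm : ∀ i, (K i ∩ D).Nonempty ∨ Touch G (K i) D) :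
    Pre G (D ∪ ⋃ i, K i) := by
  intro A ⟨a, ha, haA⟩ ⟨b, hb, hbA⟩
  by_contra! hcon
  have hmono : ∀ T : Set V, T ⊆ D ∪ ⋃ i, K i → Pre G T →
      ∀ x ∈ T, ∀ y ∈ T, x ∈ A → y ∈ A := by
    intro T hT hP x hx y hy hxA
    by_contra hyA
    obtain ⟨p, hp, q, hq, hpA, hqA, hadj⟩ := hP A ⟨x, hx, hxA⟩ ⟨y, hy, hyA⟩
    exact hcon p (hT hp) q (hT hq) hpA hqA hadj
  have hDsub : D ⊆ D ∪ ⋃ i, K i := Set.subset_union_left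
  have hKsub : ∀ i, K i ⊆ D ∪ ⋃ i, K i := fun i =>
    (Set.subset_iUnion K i).trans Set.subset_union_right
  -- each point has the same side as some point of `D`
  have hside : ∀ z ∈ D ∪ ⋃ i, K i, ∃ d ∈ D, (z ∈ A ↔ d ∈ A) := by
    rintro z (hz | hz)
    · exact ⟨z, hz, Iff.rfl⟩
    · obtain ⟨i, hi⟩ := Set.mem_iUnion.1 hz
      rcases hm i with ⟨d, hdK, hdD⟩ | ⟨x, hx, d, hd, hadj⟩
      · exact ⟨d, hdD, fun h => hmono _ (hKsub i) (hK i) z hi d hdK h,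
          fun h => hmono _ (hKsub i) (hK i) d hdK z hi h⟩
      · refine ⟨d, hd, fun h => ?_, fun h => ?_⟩
        · have hxA := hmono _ (hKsub i) (hK i) z hi x hx h
          by_contra hdA
          exact hcon x (hKsub i hx) d (hDsub hd) hxA hdA hadj
        · refine hmono _ (hKsub i) (hK i) x hx z hi ?_
          by_contra hxA
          exact hcon d (hDsub hd) x (hKsub i hx) h hxA hadj.symm
  obtain ⟨d, hd, hda⟩ := hside a ha
  obtain ⟨e, he, heb⟩ := hside b hb
  exact hbA (heb.2 (hmono _ hDsub hD d hd e he (hda.1 haA)))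

theorem Pre.union_of_touch {A B : Set V} (hA : Pre G A) (hB : Pre G B)
    (h : Touch G A B) : Pre G (A ∪ B) := by
  have := hA.union_iUnion (fun _ : Unit => B) (fun _ => hB) (fun _ => Or.inr h.symm)
  rwa [Set.iUnion_const] at this

theorem Pre.touch_diff {U A : Set V} (hU : Pre G U) (hA : A ⊆ U) (hne : A.Nonempty)
    (hne' : (U \ A).Nonempty) : Touch G A (U \ A) := by
  obtain ⟨x, -, y, hy, hxA, hyA, h⟩ := hU A (hne.imp fun a ha => ⟨hA ha, ha⟩) hne'
  exact ⟨x, hxA, y, ⟨hy, hyA⟩, h⟩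

/-- The component is the union of `K` with all preconnected subsets of `U` that meet `K`. Adding a
neighbor of this union gives another such subset, so the union is closed. -/
theorem Pre.exists_isComp {U K : Set V} (hK : Pre G K) (hKU : K ⊆ U) (hne : K.Nonempty) :
    ∃ C, IsComp G U C ∧ K ⊆ C := by
  let T : {L : Set V // Pre G L ∧ L ⊆ U ∧ (L ∩ K).Nonempty} → Set V := Subtype.val
  have hpre : Pre G (K ∪ ⋃ i, T i) :=
    hK.union_iUnion T (fun i => i.2.1) (fun i => Or.inl i.2.2.2)
  have hsub : K ∪ ⋃ i, T i ⊆ U := Set.union_subset hKU (Set.iUnion_subset fun i => i.2.2.1)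
  refine ⟨K ∪ ⋃ i, T i, ⟨hsub, ⟨hne.mono Set.subset_union_left, hpre⟩, ?_⟩,
    Set.subset_union_left⟩
  intro x hx y hy hadj
  have h1 : Pre G ((K ∪ ⋃ i, T i) ∪ {y}) :=
    hpre.union_of_touch (pre_singleton y) ⟨x, hx, y, rfl, hadj⟩
  refine Or.inr (Set.mem_iUnion.2 ⟨⟨_, h1, Set.union_subset hsub (by simpa using hy), ?_⟩,
    Or.inr rfl⟩)
  obtain ⟨a, ha⟩ := hne
  exact ⟨a, Or.inl (Or.inl ha), ha⟩

theorem exists_isComp_mem {U : Set V} {a : V} (ha : a ∈ U) : ∃ C, IsComp G U C ∧ a ∈ C := by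
  obtain ⟨C, hC, h⟩ := (pre_singleton (G := G) a).exists_isComp
    (Set.singleton_subset_iff.2 ha) ⟨a, rfl⟩
  exact ⟨C, hC, h rfl⟩

/-- A preconnected set meeting a set that it cannot leave is contained in it. -/
theorem Pre.subset_of_closed {K C : Set V} (hK : Pre G K) (hne : (K ∩ C).Nonempty)
    (hcl : ∀ x ∈ K, x ∈ C → ∀ y ∈ K, G.Adj x y → y ∈ C) : K ⊆ C := by
  intro b hb
  by_contra hbC
  obtain ⟨x, hx, y, hy, hxC, hyC, h⟩ := hK C hne ⟨b, hb, hbC⟩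
  exact hyC (hcl x hx hxC y hy h)

theorem IsComp.subset_of_inter {U C K : Set V} (hC : IsComp G U C) (hK : Pre G K)
    (hKU : K ⊆ U) (hne : (K ∩ C).Nonempty) : K ⊆ C :=
  hK.subset_of_closed hne fun x _ hxC y hy h => hC.closed x hxC y (hKU hy) h

theorem IsComp.eq_of_inter {U C D : Set V} (hC : IsComp G U C) (hD : IsComp G U D)
    (hne : (C ∩ D).Nonempty) : C = D :=
  (hD.subset_of_inter hC.conn.2 hC.sub hne).antisymm
    (hC.subset_of_inter hD.conn.2 hD.sub (by rwa [Set.inter_comm]))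

theorem IsComp.disjoint {U C D : Set V} (hC : IsComp G U C) (hD : IsComp G U D)
    (hne : C ≠ D) : Disjoint C D := by
  by_contra h
  exact hne (hC.eq_of_inter hD (Set.not_disjoint_iff_nonempty_inter.1 h))

theorem IsComp.not_touch {U C D : Set V} (hC : IsComp G U C) (hD : IsComp G U D)
    (hne : C ≠ D) : ¬ Touch G C D := by
  rintro ⟨x, hx, y, hy, h⟩
  exact hne (hC.eq_of_inter hD ⟨y, hC.closed x hx y (hD.sub hy) h, hy⟩)

theorem isComp_self {U : Set V} (hU : Conn G U) : IsComp G U U :=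
  ⟨subset_rfl, hU, fun _ _ _ hy _ => hy⟩

theorem IsComp.eq_self {U C : Set V} (hU : Conn G U) (hC : IsComp G U C) : C = U :=
  hC.eq_of_inter (isComp_self hU) (by
    rw [Set.inter_eq_left.2 hC.sub]; exact hC.conn.1)

/-- In a connected graph, the components of `U \ C` touch `C`. -/
theorem IsComp.touch_of_pre {U C D : Set V} (hU : Pre G U) (hCU : C ⊆ U) (hC : C.Nonempty)
    (hD : IsComp G (U \ C) D) : Touch G D C := by
  obtain ⟨c, hc⟩ := hC
  obtain ⟨x, hx, y, ⟨hyU, hyD⟩, h⟩ := hU.touch_diff (hD.sub.trans Set.sdiff_subset) hD.conn.1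
    ⟨c, hCU hc, fun h => (hD.sub h).2 hc⟩
  by_cases hyC : y ∈ C
  · exact ⟨x, hx, y, hyC, h⟩
  · exact (hyD (hD.closed x hx y ⟨hyU, hyC⟩ h)).elim

/-- Removing a component of `U \ C` from a connected `U` leaves a connected set. -/
theorem IsComp.pre_diff {U C D : Set V} (hU : Pre G U) (hCU : C ⊆ U) (hC : Conn G C)
    (hD : IsComp G (U \ C) D) : Pre G (U \ D) := by
  let T : {L : Set V // IsComp G (U \ C) L ∧ L ≠ D} → Set V := Subtype.val
  have h := hC.2.union_iUnion T (fun i => i.2.1.conn.2)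
    (fun i => Or.inr (i.2.1.touch_of_pre hU hCU hC.1))
  convert h using 1
  ext x
  constructor
  · rintro ⟨hxU, hxD⟩
    by_cases hxC : x ∈ C
    · exact Or.inl hxC
    · obtain ⟨E, hE, hxE⟩ := exists_isComp_mem (G := G) (U := U \ C) ⟨hxU, hxC⟩
      exact Or.inr (Set.mem_iUnion.2 ⟨⟨E, hE, fun h => hxD (h ▸ hxE)⟩, hxE⟩)
  · rintro (hx | hx)
    · exact ⟨hCU hx, fun h => (hD.sub h).2 hx⟩
    · obtain ⟨i, hi⟩ := Set.mem_iUnion.1 hx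
      exact ⟨(i.2.1.sub hi).1, fun h => (i.2.1.disjoint hD i.2.2).le_bot ⟨hi, h⟩⟩

theorem pre_of_isComp_unique {U : Set V}
    (h : ∀ C D, IsComp G U C → IsComp G U D → C = D) : Pre G U := by
  rcases U.eq_empty_or_nonempty with rfl | ⟨a, ha⟩
  · exact pre_empty
  · obtain ⟨C, hC, -⟩ := exists_isComp_mem (G := G) ha
    have : C = U := hC.sub.antisymm fun x hx => by
      obtain ⟨D, hD, hxD⟩ := exists_isComp_mem (G := G) hx
      rwa [h C D hC hD]
    exact this ▸ hC.conn.2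

/-- Two disjoint connected sets extend to a partition into two connected sets. -/
theorem Pre.exists_partition {E K L : Set V} (hE : Pre G E) (hKE : K ⊆ E) (hLE : L ⊆ E)
    (hK : Conn G K) (hL : Conn G L) (hd : Disjoint K L) :
    ∃ A B : Set V, Conn G A ∧ Conn G B ∧ Disjoint A B ∧ K ⊆ A ∧ L ⊆ B ∧ A ∪ B = E ∧
      Touch G A B := by
  -- The component of `E \ L` around `K` is one part; by `IsComp.pre_diff` its complement in `E` is
  -- connected.
  obtain ⟨A, hA, hKA⟩ := hK.2.exists_isComp (U := E \ L)
    (fun x hx => ⟨hKE hx, fun h => hd.le_bot ⟨hx, h⟩⟩) hK.1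
  have hLA : L ⊆ E \ A := fun x hx => ⟨hLE hx, fun h => (hA.sub h).2 hx⟩
  refine ⟨A, E \ A, hA.conn, ⟨hL.1.mono hLA, hA.pre_diff hE hLE hL⟩, Set.disjoint_sdiff_right,
    hKA, hLA, Set.union_sdiff_cancel (hA.sub.trans Set.sdiff_subset), ?_⟩
  exact (hA.touch_of_pre hE hLE hL.1).mono subset_rfl hLA

/-- Disjoint connected sets extend to a partition into connected sets. -/
theorem Pre.exists_absorb [Finite V] {ι : Type*} [Nonempty ι] {E : Set V} (hE : Pre G E)
    (T : ι → Set V) (hT : ∀ i, Conn G (T i)) (hTE : ∀ i, T i ⊆ E)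
    (hd : ∀ i j, i ≠ j → Disjoint (T i) (T j)) :
    ∃ T' : ι → Set V, (∀ i, Conn G (T' i)) ∧ (∀ i, T i ⊆ T' i) ∧ (⋃ i, T' i) = E ∧
      ∀ i j, i ≠ j → Disjoint (T' i) (T' j) := by
  classical
  induction hn : (E \ ⋃ i, T i).ncard using Nat.strong_induction_on generalizing T with
  | _ n ih =>
    have hsub : (⋃ i, T i) ⊆ E := Set.iUnion_subset hTE
    rcases (E \ ⋃ i, T i).eq_empty_or_nonempty with he | hne
    · exact ⟨T, hT, fun _ => subset_rfl, hsub.antisymm (Set.sdiff_eq_empty.1 he), hd⟩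
    · have hne0 : (⋃ i, T i).Nonempty := by
        obtain ⟨i⟩ := ‹Nonempty ι›
        exact (hT i).1.mono (Set.subset_iUnion T i)
      obtain ⟨x, hx, y, ⟨hyE, hyT⟩, hadj⟩ := hE.touch_diff hsub hne0 hne
      obtain ⟨i, hi⟩ := Set.mem_iUnion.1 hx
      have hyT' : ∀ j, y ∉ T j := fun j h => hyT (Set.mem_iUnion.2 ⟨j, h⟩)
      let T1 : ι → Set V := Function.update T i (T i ∪ {y})
      have hT1i : T1 i = T i ∪ {y} := Function.update_self ..
      have hT1j : ∀ j, j ≠ i → T1 j = T j := fun j hj => Function.update_of_ne hj ..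
      have hle : ∀ j, T j ⊆ T1 j := by
        intro j
        by_cases hj : j = i
        · subst hj; rw [hT1i]; exact Set.subset_union_left
        · rw [hT1j j hj]
      have hdy : ∀ j, j ≠ i → Disjoint (T1 i) (T1 j) := by
        intro j hj
        rw [hT1i, hT1j j hj, Set.disjoint_union_left]
        exact ⟨hd i j hj.symm, Set.disjoint_singleton_left.2 (hyT' j)⟩
      have hlt : (E \ ⋃ j, T1 j).ncard < n := by
        rw [← hn]
        refine Set.ncard_lt_ncard ⟨Set.sdiff_subset_sdiff_right (Set.iUnion_mono hle), ?_⟩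
          (Set.toFinite _)
        intro h
        refine (h ⟨hyE, hyT⟩).2 (Set.mem_iUnion.2 ⟨i, ?_⟩)
        rw [hT1i]; exact Or.inr rfl
      obtain ⟨T', h1, h2, h3, h4⟩ := ih _ hlt T1
        (by
          intro j
          by_cases hj : j = i
          · subst hj
            rw [hT1i]
            exact ⟨(hT j).1.mono Set.subset_union_left,
              (hT j).2.union_of_touch (pre_singleton y) ⟨x, hi, y, rfl, hadj⟩⟩
          · rw [hT1j j hj]; exact hT j)
        (by
          intro j
          by_cases hj : j = i
          · subst hj
            rw [hT1i]
            exact Set.union_subset (hTE j) (Set.singleton_subset_iff.2 hyE)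
          · rw [hT1j j hj]; exact hTE j)
        (by
          intro j l hjl
          by_cases hj : j = i
          · subst hj; exact hdy l hjl.symm
          · by_cases hl : l = i
            · subst hl; exact (hdy j hj).symm
            · rw [hT1j j hj, hT1j l hl]; exact hd j l hjl) rfl
      exact ⟨T', h1, fun j => (hle j).trans (h2 j), h3, h4⟩

theorem Conn.biUnion_hub {ι : Sort*} {D : Set V} (hD : Conn G D) (K : ι → Set V)
    (hK : ∀ i, Pre G (K i)) (hm : ∀ i, Touch G (K i) D) : Conn G (D ∪ ⋃ i, K i) :=
  ⟨hD.1.mono Set.subset_union_left, hD.2.union_iUnion K hK fun i => Or.inr (hm i)⟩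

theorem Conn.union_of_touch {A B : Set V} (hA : Conn G A) (hB : Conn G B)
    (h : Touch G A B) : Conn G (A ∪ B) :=
  ⟨hA.1.mono Set.subset_union_left, hA.2.union_of_touch hB.2 h⟩

end Connectivity

/-! ### Small transversals that keep the number of hubs bounded -/

section Helly

variable {V : Type*} {G : SimpleGraph V}

/-- Every family of pairwise intersecting connected sets has a transversal of size at most `k`. -/
def Helly (G : SimpleGraph V) (k : ℕ) : Prop :=
  ∀ 𝓑 : Set (Set V), (∀ B ∈ 𝓑, Conn G B) → (∀ A ∈ 𝓑, ∀ B ∈ 𝓑, (A ∩ B).Nonempty) →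
    ∃ Z : Set V, Z.ncard ≤ k ∧ ∀ B ∈ 𝓑, (B ∩ Z).Nonempty

/-- `U \ C` is a union of `m` preconnected sets. -/
def Hub (G : SimpleGraph V) (U C : Set V) (m : ℕ) : Prop :=
  ∃ Q : Fin m → Set V, (∀ i, Pre G (Q i)) ∧ (⋃ i, Q i) = U \ C

theorem Hub.of_pair {U C P Q : Set V} (hP : Pre G P) (hQ : Pre G Q) (h : P ∪ Q = U \ C) :
    Hub G U C 2 := by
  refine ⟨![P, Q], fun i => ?_, ?_⟩
  · fin_cases i <;> simpa
  · rw [← h]; ext x; simp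

theorem Hub.of_pre {U C : Set V} (h : Pre G (U \ C)) : Hub G U C 2 :=
  Hub.of_pair h pre_empty (Set.union_empty _)

theorem Hub.pair {U C : Set V} (h : Hub G U C 2) :
    ∃ P Q : Set V, Pre G P ∧ Pre G Q ∧ P ∪ Q = U \ C := by
  obtain ⟨Q, hQ, h⟩ := h
  refine ⟨Q 0, Q 1, hQ 0, hQ 1, ?_⟩
  rw [← h]; ext x; simp

/-- `U \ D` splits into `U \ C` and `C \ D`. -/
theorem Hub.add {U C D : Set V} {m n : ℕ} (hCU : C ⊆ U) (hDC : D ⊆ C) (h : Hub G U C m)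
    (h' : Hub G C D n) : Hub G U D (m + n) := by
  obtain ⟨P, hP, hPU⟩ := h
  obtain ⟨Q, hQ, hQU⟩ := h'
  refine ⟨Fin.append P Q, fun i => ?_, ?_⟩
  · refine Fin.addCases (fun j => ?_) (fun j => ?_) i
    · rw [Fin.append_left]; exact hP j
    · rw [Fin.append_right]; exact hQ j
  · have h1 : (⋃ i, Fin.append P Q i) = (⋃ i, P i) ∪ ⋃ i, Q i := by
      ext x
      simp only [Set.mem_iUnion, Set.mem_union]
      constructor
      · rintro ⟨i, hi⟩
        revert hi
        refine Fin.addCases (fun j => ?_) (fun j => ?_) i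
        · rw [Fin.append_left]; exact fun h => Or.inl ⟨j, h⟩
        · rw [Fin.append_right]; exact fun h => Or.inr ⟨j, h⟩
      · rintro (⟨i, hi⟩ | ⟨i, hi⟩)
        · exact ⟨Fin.castAdd n i, by rwa [Fin.append_left]⟩
        · exact ⟨Fin.natAdd m i, by rwa [Fin.append_right]⟩
    rw [h1, hPU, hQU]
    ext x
    constructor
    · rintro (⟨h1, h2⟩ | ⟨h1, h2⟩)
      · exact ⟨h1, fun h => h2 (hDC h)⟩
      · exact ⟨hCU h1, h2⟩
    · rintro ⟨h1, h2⟩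
      by_cases hC : x ∈ C
      · exact Or.inr ⟨hC, h2⟩
      · exact Or.inl ⟨h1, hC⟩

/-- If `D ⊆ C` does not touch the outside of `C`, then hubs of `D` in `C` extend to hubs in `U`. -/
theorem Hub.of_not_touch {U C D : Set V} {m : ℕ} (hU : Pre G U) (hCU : C ⊆ U) (hDC : D ⊆ C)
    (hD : Conn G D) (hnt : ¬ Touch G D (U \ C)) (h : Hub G C D m) : Hub G U D m := by
  obtain ⟨Q, hQ, hQU⟩ := h
  have hQsub : ∀ i, Q i ⊆ U \ D := fun i x hx => by
    have := hQU.subset (Set.mem_iUnion.2 ⟨i, hx⟩)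
    exact ⟨hCU this.1, this.2⟩
  have hex : ∀ i, ∃ P : Set V, Pre G P ∧ P ⊆ U \ D ∧
      ∀ E, IsComp G (U \ D) E → (Q i ∩ E).Nonempty → E = P := by
    intro i
    rcases (Q i).eq_empty_or_nonempty with he | hne
    · exact ⟨∅, pre_empty, Set.empty_subset _, fun E _ h => by simp [he] at h⟩
    · obtain ⟨P, hP, hQP⟩ := (hQ i).exists_isComp (hQsub i) hne
      exact ⟨P, hP.conn.2, hP.sub, fun E hE h =>
        hE.eq_of_inter hP (h.mono fun x hx => ⟨hx.2, hQP hx.1⟩)⟩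
  choose P hP hPs hPE using hex
  refine ⟨P, hP, (Set.iUnion_subset hPs).antisymm fun x hx => ?_⟩
  obtain ⟨E, hE, hxE⟩ := exists_isComp_mem (G := G) hx
  -- A component of `U \ D` touches `D` in a vertex of `C`, hence meets some `Q i` and equals the
  -- component around that `Q i`.
  obtain ⟨y, hyE, z, hz, hadj⟩ := hE.touch_of_pre hU (hDC.trans hCU) hD.1
  have hyC : y ∈ C := by
    by_contra hyC
    exact hnt ⟨z, hz, y, ⟨(hE.sub hyE).1, hyC⟩, hadj.symm⟩
  obtain ⟨i, hi⟩ := Set.mem_iUnion.1 (hQU.symm.subset ⟨hyC, (hE.sub hyE).2⟩)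
  rw [hPE i E hE ⟨y, hi, hyE⟩] at hxE
  exact Set.mem_iUnion.2 ⟨i, hxE⟩

/-- Let `Z` be an inclusion-minimal transversal of `𝓑` in `C`, let `R` be a component of `C \ Z`
and `D` a set that touches `R`, disjoint from `R`, which only `R` links to the rest of `C`.
Then some member of `𝓑` is contained in `R ∪ D`. -/
theorem exists_subset_of_minimal {C Z R D : Set V} {𝓑 : Set (Set V)} {P : Set V → Prop}
    (hZ : Minimal (fun Z : Set V => P Z ∧ ∀ B ∈ 𝓑, (B ∩ Z).Nonempty) Z)
    (hP : ∀ Z Z', Z' ⊆ Z → P Z → P Z') (h𝓑 : ∀ B ∈ 𝓑, Pre G B ∧ B ⊆ C)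
    (hR : IsComp G (C \ Z) R) (hne : (Z ∩ D).Nonempty)
    (hcl : ∀ x ∈ D, ∀ y ∈ C, y ∉ R → G.Adj x y → y ∈ D) :
    ∃ B ∈ 𝓑, B ⊆ R ∪ D := by
  by_contra! hcon
  have hlt : Z \ D ⊆ Z := Set.sdiff_subset
  -- A member missing `Z \ D` has all its vertices of `Z` in `D`. It can leave `R` only through `Z`,
  -- hence into `D`, and leave `D` only into `R`, so it is contained in `R ∪ D`.
  have hhit : ∀ B ∈ 𝓑, (B ∩ (Z \ D)).Nonempty := by
    intro B hB
    by_contra hno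
    have hBD : ∀ x ∈ B, x ∈ Z → x ∈ D := by
      intro x hx hxZ
      by_contra hxD
      exact hno ⟨x, hx, hxZ, hxD⟩
    obtain ⟨b, hbB, hbZ⟩ := hZ.prop.2 B hB
    refine hcon B hB ((h𝓑 B hB).1.subset_of_closed ⟨b, hbB, Or.inr (hBD b hbB hbZ)⟩ ?_)
    rintro x hx (hxR | hxD) y hy hadj
    · by_cases hyZ : y ∈ Z
      · exact Or.inr (hBD y hy hyZ)
      · exact Or.inl (hR.closed x hxR y ⟨(h𝓑 B hB).2 hy, hyZ⟩ hadj)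
    · by_cases hyR : y ∈ R
      · exact Or.inl hyR
      · exact Or.inr (hcl x hxD y ((h𝓑 B hB).2 hy) hyR hadj)
  obtain ⟨z, hz, hzD⟩ := hne
  exact (hZ.le_of_le ⟨hP _ _ hlt hZ.prop.1, hhit⟩ hlt hz).2 hzD

theorem exists_minimal_transversal [Finite V] (𝓑 : Set (Set V)) (C Z₀ : Set V) (n : ℕ)
    (hZ₀ : Z₀.ncard ≤ n) (hsub : ∀ B ∈ 𝓑, B ⊆ C) (hhit : ∀ B ∈ 𝓑, (B ∩ Z₀).Nonempty) :
    ∃ Z ⊆ Z₀, Minimal (fun Z : Set V => (Z ⊆ C ∧ Z.ncard ≤ n) ∧ ∀ B ∈ 𝓑, (B ∩ Z).Nonempty) Z := by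
  obtain ⟨Z, hZ, hm⟩ := Finite.exists_le_minimal
    (p := fun Z : Set V => (Z ⊆ C ∧ Z.ncard ≤ n) ∧ ∀ B ∈ 𝓑, (B ∩ Z).Nonempty) (a := Z₀ ∩ C)
    ⟨⟨Set.inter_subset_right,
      (Set.ncard_le_ncard Set.inter_subset_left (Set.toFinite _)).trans hZ₀⟩, fun B hB => by
        obtain ⟨x, hx, hxZ⟩ := hhit B hB
        exact ⟨x, hx, hxZ, hsub B hB hx⟩⟩
  exact ⟨Z, hZ.trans Set.inter_subset_left, hm⟩

theorem size_prop_mono [Finite V] {C : Set V} {n : ℕ} (Z Z' : Set V) (h : Z' ⊆ Z)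
    (hZ : Z ⊆ C ∧ Z.ncard ≤ n) : Z' ⊆ C ∧ Z'.ncard ≤ n :=
  ⟨h.trans hZ.1, (Set.ncard_le_ncard h (Set.toFinite _)).trans hZ.2⟩

/-- Pairwise intersecting connected subsets of a connected set `U` have a small transversal `Z`
such that removing a component of `U \ Z` from `U` leaves a connected set. -/
theorem Helly.exists_transversal [Finite V] {k : ℕ} (hk : Helly G k) {U : Set V} (hU : Conn G U)
    (𝓕 : Set (Set V)) (hc : ∀ B ∈ 𝓕, Conn G B ∧ B ⊆ U)
    (hi : ∀ A ∈ 𝓕, ∀ B ∈ 𝓕, (A ∩ B).Nonempty) :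
    ∃ Z ⊆ U, Z.ncard ≤ k ∧ (∀ B ∈ 𝓕, (B ∩ Z).Nonempty) ∧
      ∀ C, IsComp G (U \ Z) C → Pre G (U \ C) := by
  -- Enlarging the family to a maximal one costs nothing. A component `C` of `U \ Z` misses `Z`, so
  -- it is not a member, and maximality then gives a member `M` disjoint from `C`.
  obtain ⟨𝓜, h𝓕𝓜, hmax⟩ := Finite.exists_le_maximal
    (p := fun 𝓜 : Set (Set V) => (∀ B ∈ 𝓜, Conn G B ∧ B ⊆ U) ∧
      ∀ A ∈ 𝓜, ∀ B ∈ 𝓜, (A ∩ B).Nonempty) (a := 𝓕) ⟨hc, hi⟩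
  obtain ⟨hMc, hMi⟩ := hmax.prop
  obtain ⟨Z₀, hZ₀, hhit⟩ := hk 𝓜 (fun B hB => (hMc B hB).1) hMi
  obtain ⟨Z, -, hZ⟩ := exists_minimal_transversal 𝓜 U Z₀ k hZ₀ (fun B hB => (hMc B hB).2) hhit
  refine ⟨Z, hZ.prop.1.1, hZ.prop.1.2, fun B hB => hZ.prop.2 B (h𝓕𝓜 hB), fun C hC => ?_⟩
  have hCU : C ⊆ U := hC.sub.trans Set.sdiff_subset
  refine pre_of_isComp_unique fun D₁ D₂ h₁ h₂ => ?_
  -- By minimality of `Z`, each component `D` of `U \ C` has a member inside `C ∪ D`. As `M` meets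
  -- that member and avoids `C`, it lies in `D`; so there is only one `D`.
  have key : ∀ D, IsComp G (U \ C) D → ∃ B ∈ 𝓜, B ⊆ C ∪ D := by
    intro D hD
    refine exists_subset_of_minimal hZ size_prop_mono
      (fun B hB => ⟨(hMc B hB).1.2, (hMc B hB).2⟩) hC ?_ ?_
    · obtain ⟨x, hx, y, hy, hadj⟩ := hD.touch_of_pre hU.2 hCU hC.conn.1
      refine ⟨x, ?_, hx⟩
      by_contra hxZ
      exact (hD.sub hx).2 (hC.closed y hy x ⟨(hD.sub hx).1, hxZ⟩ hadj.symm)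
    · exact fun x hx y hy hyC hadj => hD.closed x hx y ⟨hy, hyC⟩ hadj
  obtain ⟨M, hM, hMC⟩ : ∃ M ∈ 𝓜, M ∩ C = ∅ := by
    by_contra! hcon
    have hins : insert C 𝓜 ≤ 𝓜 := by
      refine hmax.le_of_ge ⟨?_, ?_⟩ (Set.subset_insert _ _)
      · rintro B (rfl | hB)
        · exact ⟨hC.conn, hCU⟩
        · exact hMc B hB
      · rintro A (rfl | hA) B (rfl | hB)
        · rw [Set.inter_self]; exact hC.conn.1
        · rw [Set.inter_comm]; exact hcon B hB
        · exact hcon A hA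
        · exact hMi A hA B hB
    obtain ⟨x, hx, hxZ⟩ := hZ.prop.2 C (hins (Set.mem_insert _ _))
    exact (hC.sub hx).2 hxZ
  have hMD : ∀ D, IsComp G (U \ C) D → M ⊆ D := by
    intro D hD
    obtain ⟨B, hB, hBD⟩ := key D hD
    obtain ⟨x, hxM, hxB⟩ := hMi M hM B hB
    have hMsub : M ⊆ U \ C := fun y hy =>
      ⟨(hMc M hM).2 hy, fun h => (Set.eq_empty_iff_forall_notMem.1 hMC) y ⟨hy, h⟩⟩
    refine hD.subset_of_inter (hMc M hM).1.2 hMsub ⟨x, hxM, ?_⟩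
    rcases hBD hxB with h | h
    · exact ((hMsub hxM).2 h).elim
    · exact h
  obtain ⟨x, hx⟩ := (hMc M hM).1.1
  exact h₁.eq_of_inter h₂ ⟨x, hMD _ h₁ hx, hMD _ h₂ hx⟩

/-- `P` and `Q` are nonempty and in different components of `U \ B`. -/
def Sep (G : SimpleGraph V) (U B P Q : Set V) : Prop :=
  P.Nonempty ∧ Q.Nonempty ∧
    ∀ K ⊆ U \ B, Pre G K → (K ∩ P).Nonempty → (K ∩ Q).Nonempty → False

/-- The components of `U \ B₁` around `P` and `Q` are joined through `B₁`, and both avoid the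
component containing `B₂`. This links `P` to `Q` in `U \ B₂`. -/
theorem false_of_sep {U B₁ B₂ E P Q : Set V} (hU : Pre G U) (hB₁ : Conn G B₁) (hBU : B₁ ⊆ U)
    (hd : Disjoint B₁ B₂) (hE : IsComp G (U \ B₁) E) (hB₂E : B₂ ⊆ E)
    (hP : Pre G P) (hQ : Pre G Q) (hPU : P ⊆ U \ B₁) (hQU : Q ⊆ U \ B₁)
    (hPE : ¬ (P ∩ E).Nonempty) (hQE : ¬ (Q ∩ E).Nonempty) (hs : Sep G U B₂ P Q) : False := by
  obtain ⟨D₁, hD₁, hPD⟩ := hP.exists_isComp hPU hs.1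
  obtain ⟨D₂, hD₂, hQD⟩ := hQ.exists_isComp hQU hs.2.1
  have hne : ∀ D P, IsComp G (U \ B₁) D → P.Nonempty → P ⊆ D → ¬ (P ∩ E).Nonempty →
      Disjoint D E := by
    intro D P hD hPn hPD hPE
    refine hD.disjoint hE ?_
    rintro rfl
    exact hPE (by rwa [Set.inter_eq_left.2 hPD])
  have h1 := hne D₁ P hD₁ hs.1 hPD hPE
  have h2 := hne D₂ Q hD₂ hs.2.1 hQD hQE
  have hpre : Pre G ((B₁ ∪ D₁) ∪ D₂) :=
    (hB₁.2.union_of_touch hD₁.conn.2 (hD₁.touch_of_pre hU hBU hB₁.1).symm).union_of_touch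
      hD₂.conn.2 ((hD₂.touch_of_pre hU hBU hB₁.1).symm.mono Set.subset_union_left subset_rfl)
  refine hs.2.2 _ ?_ hpre ?_ ?_
  · rintro x ((hx | hx) | hx)
    · exact ⟨hBU hx, fun h => hd.le_bot ⟨hx, h⟩⟩
    · exact ⟨(hD₁.sub hx).1, fun h => h1.le_bot ⟨hx, hB₂E h⟩⟩
    · exact ⟨(hD₂.sub hx).1, fun h => h2.le_bot ⟨hx, hB₂E h⟩⟩
  · exact hs.1.imp fun x hx => ⟨Or.inl (Or.inr (hPD hx)), hx⟩
  · exact hs.2.1.imp fun x hx => ⟨Or.inr (hQD hx), hx⟩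

/-- From `m` hubs to at most two, at the cost of few vertices. -/
theorem Helly.exists_hub_two [Finite V] {k m : ℕ} (hk : Helly G k) {U C : Set V} (hU : Pre G U)
    (hCU : C ⊆ U) (h : Hub G U C m) :
    ∃ Z ⊆ C, Z.ncard ≤ m ^ 3 * k ∧ ∀ D, IsComp G (C \ Z) D → Hub G U D 2 := by
  classical
  obtain ⟨Q, hQ, hQU⟩ := h
  have hQsub : ∀ i, Q i ⊆ U \ C := fun i x hx => hQU.subset (Set.mem_iUnion.2 ⟨i, hx⟩)
  let 𝓑 : Fin m × Fin m × Fin m → Set (Set V) := fun τ =>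
    {B | Conn G B ∧ B ⊆ C ∧ Sep G U B (Q τ.1) (Q τ.2.1) ∧ Sep G U B (Q τ.1) (Q τ.2.2) ∧
      Sep G U B (Q τ.2.1) (Q τ.2.2)}
  have hint : ∀ τ, ∀ A ∈ 𝓑 τ, ∀ B ∈ 𝓑 τ, (A ∩ B).Nonempty := by
    rintro ⟨i, j, l⟩ A ⟨hA, hAC, h1, h2, h3⟩ B ⟨hB, hBC, h1', h2', h3'⟩
    by_contra hdis
    have hd : Disjoint A B := by
      rwa [← Set.not_disjoint_iff_nonempty_inter, not_not] at hdis
    -- At most one of the three sets separated by `A` meets the component `E` of `U \ A` that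
    -- contains `B`. The other two are linked around `B`, against `false_of_sep`.
    obtain ⟨E, hE, hBE⟩ := hB.2.exists_isComp (U := U \ A)
      (fun x hx => ⟨hCU (hBC hx), fun h => hd.le_bot ⟨h, hx⟩⟩) hB.1
    have hQA : ∀ i, Q i ⊆ U \ A := fun i x hx =>
      ⟨(hQsub i hx).1, fun h => (hQsub i hx).2 (hAC h)⟩
    have hsome : ∀ p q, Sep G U A (Q p) (Q q) →
        ¬ (Q p ∩ E).Nonempty ∨ ¬ (Q q ∩ E).Nonempty := by
      intro p q hs
      by_contra! hcon
      refine hs.2.2 E hE.sub hE.conn.2 ?_ ?_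
      · rw [Set.inter_comm]; exact hcon.1
      · rw [Set.inter_comm]; exact hcon.2
    have hfin : ∀ p q, ¬ (Q p ∩ E).Nonempty → ¬ (Q q ∩ E).Nonempty →
        ¬ Sep G U B (Q p) (Q q) := fun p q hp hq hs =>
      false_of_sep hU hA (hAC.trans hCU) hd hE hBE (hQ p) (hQ q) (hQA p) (hQA q) hp hq hs
    simp only at h1 h2 h3 h1' h2' h3'
    rcases hsome _ _ h1 with a | a <;> rcases hsome _ _ h2 with b | b <;>
      rcases hsome _ _ h3 with c | c
    · exact hfin _ _ a c h1'
    · exact hfin _ _ a c h2'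
    · exact hfin _ _ a c h1'
    · exact hfin _ _ a c h2'
    · exact hfin _ _ b a h1'
    · exact hfin _ _ b a h1'
    · exact hfin _ _ a b h3'
    · exact hfin _ _ a b h3'
  choose Zτ hZτ hhit using fun τ => hk (𝓑 τ) (fun B hB => hB.1) (hint τ)
  have hcard : (⋃ τ, Zτ τ).ncard ≤ m ^ 3 * k := by
    refine (Set.ncard_iUnion_le_of_fintype Zτ).trans ?_
    refine (Finset.sum_le_card_nsmul _ _ k fun τ _ => hZτ τ).trans ?_
    simp [Fintype.card_prod, pow_succ, mul_assoc]
  obtain ⟨Z, -, hZ⟩ := exists_minimal_transversal (⋃ τ, 𝓑 τ) C _ _ hcard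
    (fun B hB => by obtain ⟨τ, hτ⟩ := Set.mem_iUnion.1 hB; exact hτ.2.1)
    (fun B hB => by
      obtain ⟨τ, hτ⟩ := Set.mem_iUnion.1 hB
      exact (hhit τ B hτ).mono (Set.inter_subset_inter_right _ (Set.subset_iUnion _ τ)))
  refine ⟨Z, hZ.prop.1.1, hZ.prop.1.2, fun D hD => ?_⟩
  have hDC : D ⊆ C := hD.sub.trans Set.sdiff_subset
  have hDU : D ⊆ U := hDC.trans hCU
  have hQD : ∀ i, Q i ⊆ U \ D := fun i x hx =>
    ⟨(hQsub i hx).1, fun h => (hQsub i hx).2 (hDC h)⟩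
  have hDnot : ∀ τ, D ∉ 𝓑 τ := fun τ hτ => by
    obtain ⟨x, hx, hxZ⟩ := hZ.prop.2 D (Set.mem_iUnion.2 ⟨τ, hτ⟩)
    exact (hD.sub hx).2 hxZ
  -- A component `E` that meets no `Q i` lies in `C`, so by minimality some separating `B` is
  -- contained in `D ∪ E`. No connection between two of the `Q i` in `U \ D` can use `E`, so `D`
  -- itself separates the same triple, although `D` misses `Z`.
  have hmeet : ∀ E, IsComp G (U \ D) E → ∃ i, (Q i ∩ E).Nonempty := by
    intro E hE
    by_contra! hcon
    have hEC : E ⊆ C := by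
      intro x hx
      by_contra hxC
      obtain ⟨i, hi⟩ := Set.mem_iUnion.1 (hQU.symm.subset ⟨(hE.sub hx).1, hxC⟩)
      exact (Set.eq_empty_iff_forall_notMem.1 (hcon i)) x ⟨hi, hx⟩
    obtain ⟨B, hB, hBsub⟩ := exists_subset_of_minimal (D := E) hZ size_prop_mono
      (fun B hB => by
        obtain ⟨τ, hτ⟩ := Set.mem_iUnion.1 hB
        exact ⟨hτ.1.2, hτ.2.1⟩) hD
      (by
        obtain ⟨x, hx, y, hy, hadj⟩ := hE.touch_of_pre hU hDU hD.conn.1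
        refine ⟨x, ?_, hx⟩
        by_contra hxZ
        exact (hE.sub hx).2 (hD.closed y hy x ⟨hEC hx, hxZ⟩ hadj.symm))
      (fun x hx y hy hyD hadj => hE.closed x hx y ⟨hCU hy, hyD⟩ hadj)
    obtain ⟨τ, hτ⟩ := Set.mem_iUnion.1 hB
    have hsep : ∀ p q, Sep G U B (Q p) (Q q) → Sep G U D (Q p) (Q q) := by
      refine fun p q hs => ⟨hs.1, hs.2.1, fun K hK hKp h1 h2 => hs.2.2 K ?_ hKp h1 h2⟩
      intro x hx
      refine ⟨(hK hx).1, fun hxB => ?_⟩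
      rcases hBsub hxB with hxD | hxE
      · exact (hK hx).2 hxD
      · obtain ⟨z, hzK, hzQ⟩ := h1
        exact (Set.eq_empty_iff_forall_notMem.1 (hcon p)) z
          ⟨hzQ, hE.subset_of_inter hKp hK ⟨x, hx, hxE⟩ hzK⟩
    exact hDnot τ ⟨hD.conn, hDC, hsep _ _ hτ.2.2.1, hsep _ _ hτ.2.2.2.1, hsep _ _ hτ.2.2.2.2⟩
  -- Every component of `U \ D` meets some `Q i`, and three components would put `D` into some `𝓑
  -- τ`. So there are at most two.
  by_cases hex : ∃ i, (Q i).Nonempty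
  · obtain ⟨i, hi⟩ := hex
    obtain ⟨E, hE, hQE⟩ := (hQ i).exists_isComp (hQD i) hi
    by_cases hex2 : ∃ j, (Q j).Nonempty ∧ ¬ Q j ⊆ E
    · obtain ⟨j, hj, hjE⟩ := hex2
      obtain ⟨E', hE', hQE'⟩ := (hQ j).exists_isComp (hQD j) hj
      have hsep : ∀ p q A, IsComp G (U \ D) A → Q p ⊆ A → (Q p).Nonempty → (Q q).Nonempty →
          ¬ Q q ⊆ A → Sep G U D (Q p) (Q q) := by
        refine fun p q A hA hpA hp hq hqA => ⟨hp, hq, fun K hK hKp h1 h2 => hqA ?_⟩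
        have hKA : K ⊆ A := hA.subset_of_inter hKp hK (h1.mono fun x hx => ⟨hx.1, hpA hx.2⟩)
        refine hA.subset_of_inter (hQ q) (hQD q) ?_
        obtain ⟨x, hx, hxq⟩ := h2
        exact ⟨x, hxq, hKA hx⟩
      refine Hub.of_pair hE.conn.2 hE'.conn.2
        ((Set.union_subset hE.sub hE'.sub).antisymm fun x hx => ?_)
      obtain ⟨A, hA, hxA⟩ := exists_isComp_mem (G := G) hx
      obtain ⟨l, hl⟩ := hmeet A hA
      by_contra hxn
      have hlE : ∀ E, IsComp G (U \ D) E → x ∉ E → ¬ Q l ⊆ E := by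
        intro E hE hxE hle
        obtain ⟨y, hy, hyA⟩ := hl
        exact hxE (hE.eq_of_inter hA ⟨y, hle hy, hyA⟩ ▸ hxA)
      have hln : (Q l).Nonempty := hl.mono Set.inter_subset_left
      exact hDnot (i, j, l) ⟨hD.conn, hDC, hsep i j E hE hQE hi hj hjE,
        hsep i l E hE hQE hi hln (hlE E hE fun h => hxn (Or.inl h)),
        hsep j l E' hE' hQE' hj hln (hlE E' hE' fun h => hxn (Or.inr h))⟩
    · push Not at hex2
      refine Hub.of_pair hE.conn.2 pre_empty ?_
      rw [Set.union_empty]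
      refine hE.sub.antisymm fun x hx => ?_
      obtain ⟨A, hA, hxA⟩ := exists_isComp_mem (G := G) hx
      obtain ⟨l, y, hy, hyA⟩ := hmeet A hA
      rwa [hE.eq_of_inter hA ⟨y, hex2 l ⟨y, hy⟩ hy, hyA⟩]
  · refine Hub.of_pair pre_empty pre_empty ?_
    rw [Set.union_empty]
    symm
    by_contra hne
    obtain ⟨x, hx⟩ := Set.nonempty_iff_ne_empty.2 hne
    obtain ⟨A, hA, -⟩ := exists_isComp_mem (G := G) hx
    obtain ⟨l, y, hy, -⟩ := hmeet A hA
    exact hex ⟨l, y, hy⟩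

end Helly

/-! ### Weak coloring numbers under nested deletions -/

section Orders

variable {V : Type*} {G : SimpleGraph V}

/-- Weak reachability inside `U`, along walks and for a ranking `σ` of the vertices that may
have ties. -/
def wr (G : SimpleGraph V) (r : ℕ) (U S : Set V) (σ : V → ℕ) (u : V) : Set V :=
  {v | v ∈ S ∧ ∃ p : G.Walk u v, p.length ≤ r ∧ (∀ x ∈ p.support, x ∈ U) ∧
    ∀ x ∈ p.support, x ∈ S → σ v ≤ σ x}

/-- The weak coloring number of `S` in `G[U]` is at most `n`. -/
def WC (G : SimpleGraph V) (r : ℕ) (U S : Set V) (n : ℕ) : Prop :=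
  ∃ σ : V → ℕ, ∀ u ∈ U, (wr G r U S σ u).ncard ≤ n

theorem WC.mono {r n m : ℕ} {U S : Set V} (h : WC G r U S n) (hnm : n ≤ m) : WC G r U S m :=
  h.imp fun _ h u hu => (h u hu).trans hnm

theorem WC.of_ncard_le [Finite V] {r n : ℕ} {U S : Set V} (h : S.ncard ≤ n) : WC G r U S n :=
  ⟨fun _ => 0, fun _ _ => (Set.ncard_le_ncard (fun _ hv => hv.1) (Set.toFinite _)).trans h⟩

theorem IsComp.support_subset {U C : Set V} (hC : IsComp G U C) {u v : V} (p : G.Walk u v)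
    (hu : u ∈ C) (hp : ∀ x ∈ p.support, x ∈ U) : ∀ x ∈ p.support, x ∈ C := by
  induction p with
  | nil => simpa using hu
  | cons h p ih =>
    simp only [SimpleGraph.Walk.support_cons, List.mem_cons, forall_eq_or_imp] at hp ⊢
    exact ⟨hu, ih (hC.closed _ hu _ (hp.2 _ p.start_mem_support) h) hp.2⟩

/-- Rank `S₁` first and then the parts of `T` in the components of `U \ S₁`. -/
theorem exists_rank_compose [Finite V] {U S₁ T : Set V} (hT : T ⊆ U \ S₁) (σ₁ : V → ℕ)
    (σ₂ : Set V → V → ℕ) :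
    ∃ σ : V → ℕ, ∀ r, ∀ u, ∀ v ∈ wr G r U (S₁ ∪ T) σ u, v ∈ wr G r U S₁ σ₁ u ∨
      ∃ C, IsComp G (U \ S₁) C ∧ u ∈ C ∧ v ∈ wr G r C (T ∩ C) (σ₂ C) u := by
  classical
  obtain ⟨N, hN⟩ := (Set.finite_range σ₁).bddAbove
  have hN' : ∀ x, σ₁ x < N + 1 := fun x => Nat.lt_succ_of_le (hN ⟨x, rfl⟩)
  choose! cp hcp using fun x (hx : x ∈ U \ S₁) => exists_isComp_mem (G := G) hx
  -- `N + 1` exceeds all values of `σ₁`, so `S₁` is ranked first. A walk whose minimum lies in `T`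
  -- thus avoids `S₁` and stays in one component of `U \ S₁`.
  refine ⟨fun x => if x ∈ S₁ then σ₁ x else N + 1 + σ₂ (cp x) x, fun r u v hv => ?_⟩
  obtain ⟨hvS, p, hpr, hpU, hmin⟩ := hv
  by_cases hv1 : v ∈ S₁
  · refine Or.inl ⟨hv1, p, hpr, hpU, fun x hx hxS => ?_⟩
    have := hmin x hx (Or.inl hxS)
    simpa [hv1, hxS] using this
  · right
    have hvT : v ∈ T := hvS.resolve_left hv1
    have hpS : ∀ x ∈ p.support, x ∈ U \ S₁ := by
      refine fun x hx => ⟨hpU x hx, fun hxS => ?_⟩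
      have := hmin x hx (Or.inl hxS)
      simp only [hv1, hxS, if_true, if_false] at this
      have := hN' x
      omega
    obtain ⟨C, hC, huC⟩ := exists_isComp_mem (G := G) (hpS u p.start_mem_support)
    have hpC := hC.support_subset p huC hpS
    have hcpC : ∀ x ∈ C, cp x = C := fun x hx =>
      (hcp x (hC.sub hx)).1.eq_of_inter hC ⟨x, (hcp x (hC.sub hx)).2, hx⟩
    have hvC := hpC v p.end_mem_support
    refine ⟨C, hC, huC, ⟨hvT, hvC⟩, p, hpr, hpC, fun x hx hxT => ?_⟩
    have := hmin x hx (Or.inr hxT.1)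
    simp only [hv1, (hT hxT.1).2, if_false, hcpC x hxT.2, hcpC v hvC] at this
    omega

/-- Only one component of `U \ S₁` can contain `u`, so a single `n₂` is added, however many
components there are. -/
theorem WC.compose [Finite V] {r n₁ n₂ : ℕ} {U S₁ T : Set V} (hT : T ⊆ U \ S₁)
    (h₁ : WC G r U S₁ n₁) (h₂ : ∀ C, IsComp G (U \ S₁) C → WC G r C (T ∩ C) n₂) :
    WC G r U (S₁ ∪ T) (n₁ + n₂) := by
  obtain ⟨σ₁, h₁⟩ := h₁
  choose! σ₂ h₂ using h₂
  obtain ⟨σ, hσ⟩ := exists_rank_compose (G := G) hT σ₁ σ₂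
  refine ⟨σ, fun u hu => ?_⟩
  by_cases hC : ∃ C, IsComp G (U \ S₁) C ∧ u ∈ C
  · obtain ⟨C, hC, huC⟩ := hC
    have hsub : wr G r U (S₁ ∪ T) σ u ⊆ wr G r U S₁ σ₁ u ∪ wr G r C (T ∩ C) (σ₂ C) u := by
      intro v hv
      rcases hσ r u v hv with h | ⟨D, hD, huD, h⟩
      · exact Or.inl h
      · rw [hD.eq_of_inter hC ⟨u, huD, huC⟩] at h
        exact Or.inr h
    refine (Set.ncard_le_ncard hsub (Set.toFinite _)).trans ((Set.ncard_union_le _ _).trans ?_)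
    exact Nat.add_le_add (h₁ u hu) (h₂ C hC u huC)
  · have hsub : wr G r U (S₁ ∪ T) σ u ⊆ wr G r U S₁ σ₁ u := by
      intro v hv
      rcases hσ r u v hv with h | ⟨D, hD, huD, h⟩
      · exact h
      · exact (hC ⟨D, hD, huD⟩).elim
    exact (Set.ncard_le_ncard hsub (Set.toFinite _)).trans ((h₁ u hu).trans (Nat.le_add_right _ _))

/-- There is `S ⊆ U` that meets every connected subset of `U` in `F`, such that every component of
`U \ S` has at most `m` hubs in `W`, and with weak coloring numbers bounded by `b`. -/
def Solvable (G : SimpleGraph V) (W U : Set V) (F : Set V → Prop) (m : ℕ) (b : ℕ → ℕ) : Prop :=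
  ∃ S ⊆ U, (∀ K ⊆ U \ S, Conn G K → ¬ F K) ∧ (∀ C, IsComp G (U \ S) C → Hub G W C m) ∧
    ∀ r, 2 ≤ r → WC G r U S (b r)

theorem Solvable.mono {W U : Set V} {F : Set V → Prop} {m : ℕ} {b b' : ℕ → ℕ}
    (h : Solvable G W U F m b) (hb : ∀ r, 2 ≤ r → b r ≤ b' r) : Solvable G W U F m b' := by
  obtain ⟨S, hS, h1, h2, h3⟩ := h
  exact ⟨S, hS, h1, h2, fun r hr => (h3 r hr).mono (hb r hr)⟩

theorem Solvable.of_free [Finite V] {U : Set V} {F : Set V → Prop} {b : ℕ → ℕ} (hU : Conn G U)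
    (h : ∀ K ⊆ U, Conn G K → ¬ F K) : Solvable G U U F 2 b := by
  refine ⟨∅, Set.empty_subset _, by simpa using h, fun C hC => ?_, fun r _ =>
    WC.of_ncard_le (by simp)⟩
  rw [Set.sdiff_empty] at hC
  rw [hC.eq_self hU]
  exact Hub.of_pre (by simpa using pre_empty)

/-- The set `W` in which hubs are counted stays fixed while the set to be solved shrinks to the
components. -/
theorem Solvable.compose [Finite V] {W U S₁ : Set V} {F : Set V → Prop} {m : ℕ} {b₁ b₂ : ℕ → ℕ}
    (hS₁ : S₁ ⊆ U) (h₁ : ∀ r, 2 ≤ r → WC G r U S₁ (b₁ r))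
    (h₂ : ∀ C, IsComp G (U \ S₁) C → Solvable G W C F m b₂) :
    Solvable G W U F m (fun r => b₁ r + b₂ r) := by
  choose! S hS hF hH hW using h₂
  let T : Set V := ⋃ C : {C // IsComp G (U \ S₁) C}, S C.1
  have hT : T ⊆ U \ S₁ := Set.iUnion_subset fun C => (hS C.1 C.2).trans C.2.sub
  have hTC : ∀ C, IsComp G (U \ S₁) C → T ∩ C = S C := by
    intro C hC
    ext x
    constructor
    · rintro ⟨hx, hxC⟩
      obtain ⟨D, hD⟩ := Set.mem_iUnion.1 hx
      rwa [← D.2.eq_of_inter hC ⟨x, hS D.1 D.2 hD, hxC⟩]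
    · exact fun hx => ⟨Set.mem_iUnion.2 ⟨⟨C, hC⟩, hx⟩, hS C hC hx⟩
  have hin : ∀ K ⊆ U \ (S₁ ∪ T), Conn G K → ∃ C, IsComp G (U \ S₁) C ∧ K ⊆ C \ S C := by
    intro K hK hc
    obtain ⟨C, hC, hKC⟩ := hc.2.exists_isComp (U := U \ S₁)
      (fun x hx => ⟨(hK hx).1, fun h => (hK hx).2 (Or.inl h)⟩) hc.1
    exact ⟨C, hC, fun x hx => ⟨hKC hx, fun h =>
      (hK hx).2 (Or.inr ((hTC C hC).symm.subset h).1)⟩⟩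
  refine ⟨S₁ ∪ T, Set.union_subset hS₁ (hT.trans Set.sdiff_subset), fun K hK hc => ?_,
    fun D hD => ?_, fun r hr => ?_⟩
  · obtain ⟨C, hC, hKC⟩ := hin K hK hc
    exact hF C hC K hKC hc
  · obtain ⟨C, hC, hDC⟩ := hin D hD.sub hD.conn
    refine hH C hC D ⟨hDC, hD.conn, fun x hx y hy hadj => hD.closed x hx y ?_ hadj⟩
    refine ⟨(hC.sub hy.1).1, ?_⟩
    rintro (h | h)
    · exact (hC.sub hy.1).2 h
    · exact hy.2 ((hTC C hC).subset ⟨h, hy.1⟩)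
  · exact (h₁ r hr).compose hT fun C hC => by rw [hTC C hC]; exact hW C hC r hr

/-- Nesting increases the number of hubs; deleting `m ^ 3 * k` further vertices in each remaining
component brings it back to two, so that solutions can be nested again. -/
theorem Solvable.restore [Finite V] {k m : ℕ} (hk : Helly G k) {U : Set V} {F : Set V → Prop}
    {b : ℕ → ℕ} (hU : Conn G U) (h : Solvable G U U F m b) :
    Solvable G U U F 2 (fun r => b r + m ^ 3 * k) := by
  obtain ⟨S, hS, hF, hH, hW⟩ := h
  refine Solvable.compose hS hW fun C hC => ?_
  obtain ⟨Z, hZ, hZc, hZH⟩ := hk.exists_hub_two hU.2 (hC.sub.trans Set.sdiff_subset) (hH C hC)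
  exact ⟨Z, hZ, fun K hK => hF K (hK.trans (Set.sdiff_subset.trans hC.sub)), hZH,
    fun r _ => WC.of_ncard_le hZc⟩

theorem Solvable.hub_add {W U : Set V} {F : Set V → Prop} {m n : ℕ}
    {b : ℕ → ℕ} (hUW : U ⊆ W) (hH : Hub G W U m) (h : Solvable G U U F n b) :
    Solvable G W U F (m + n) b := by
  obtain ⟨S, hS, hF, hH', hW⟩ := h
  exact ⟨S, hS, hF, fun C hC => hH.add hUW (hC.sub.trans Set.sdiff_subset) (hH' C hC), hW⟩

/-- Two hubs of `C` in `U` and two inside `C` make four, and `4 ^ 3 = 64`. -/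
theorem Solvable.compose_restore [Finite V] {k : ℕ} (hk : Helly G k) {U S₁ : Set V}
    {F : Set V → Prop} {b₁ b₂ : ℕ → ℕ} (hU : Conn G U) (hS₁ : S₁ ⊆ U)
    (hH : ∀ C, IsComp G (U \ S₁) C → Hub G U C 2)
    (h₁ : ∀ r, 2 ≤ r → WC G r U S₁ (b₁ r))
    (h₂ : ∀ C, IsComp G (U \ S₁) C → Solvable G C C F 2 b₂) :
    Solvable G U U F 2 (fun r => b₁ r + b₂ r + 64 * k) :=
  (Solvable.compose hS₁ h₁ fun C hC =>
    (h₂ C hC).hub_add (hC.sub.trans Set.sdiff_subset) (hH C hC)).restore hk hU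

/-- Solving the problem for a family, and then in the remaining components. -/
theorem Solvable.bind [Finite V] {k : ℕ} (hk : Helly G k) {U : Set V}
    {F F' : Set V → Prop} {b₁ b₂ : ℕ → ℕ} (hU : Conn G U) (h₁ : Solvable G U U F' 2 b₁)
    (h₂ : ∀ C ⊆ U, Conn G C → ¬ F' C → (∀ K ⊆ C, Conn G K → ¬ F' K) → Solvable G C C F 2 b₂) :
    ∃ S ⊆ U, (∀ K ⊆ U \ S, Conn G K → ¬ F' K ∧ ¬ F K) ∧
      (∀ C, IsComp G (U \ S) C → Hub G U C 2) ∧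
      ∀ r, 2 ≤ r → WC G r U S (b₁ r + b₂ r + 64 * k) := by
  obtain ⟨S, hS, hF, hH, hW⟩ := h₁
  obtain ⟨S', hS', hF', hH', hW'⟩ := Solvable.compose_restore (F := fun K => F' K ∨ F K) hk hU
    hS hH hW (b₂ := b₂) fun C hC => by
      have hfree : ∀ K ⊆ C, Conn G K → ¬ F' K := fun K hK => hF K (hK.trans hC.sub)
      obtain ⟨T, hT, h1, h2, h3⟩ := h₂ C (hC.sub.trans Set.sdiff_subset) hC.conn
        (hF C hC.sub hC.conn) hfree
      exact ⟨T, hT, fun K hK hc h => h.elim (hfree K (hK.trans Set.sdiff_subset) hc) (h1 K hK hc),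
        h2, h3⟩
  exact ⟨S', hS', fun K hK hc => not_or.1 (hF' K hK hc), hH', hW'⟩

/-- It suffices to solve the problem in the connected subsets that contain no member of a family of
pairwise intersecting connected sets. -/
theorem Solvable.of_intersecting [Finite V] {k : ℕ} (hk : Helly G k) {U : Set V}
    {F : Set V → Prop} {b : ℕ → ℕ} (hU : Conn G U) (P : Set V → Prop)
    (hP : ∀ A ⊆ U, ∀ B ⊆ U, Conn G A → Conn G B → P A → P B → ¬ Disjoint A B)
    (h : ∀ C ⊆ U, Conn G C → ¬ P C → Solvable G C C F 2 b) :
    Solvable G U U F 2 (fun r => k + b r + 64 * k) := by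
  obtain ⟨Z, hZU, hZ, hhit, hpre⟩ := hk.exists_transversal hU {A | A ⊆ U ∧ Conn G A ∧ P A}
    (fun B hB => ⟨hB.2.1, hB.1⟩)
    (fun A hA B hB => Set.not_disjoint_iff_nonempty_inter.1
      (hP A hA.1 B hB.1 hA.2.1 hB.2.1 hA.2.2 hB.2.2))
  refine Solvable.compose_restore hk hU hZU (fun C hC => Hub.of_pre (hpre C hC))
    (fun r _ => WC.of_ncard_le hZ) fun C hC => ?_
  refine h C (hC.sub.trans Set.sdiff_subset) hC.conn fun hPC => ?_
  obtain ⟨x, hx, hxZ⟩ := hhit C ⟨hC.sub.trans Set.sdiff_subset, hC.conn, hPC⟩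
  exact (hC.sub hx).2 hxZ

end Orders

universe u u' u'' v

/-! ### Rich models, disjoint unions and attaching a graph to a vertex -/

section Models

/-- `B` is a model of `X` inside `U` whose branch sets satisfy `F`. -/
structure Model {W : Type u} {V : Type v} (X : SimpleGraph W) (G : SimpleGraph V)
    (F : Set V → Prop) (U : Set V) (B : W → Set V) : Prop where
  conn : ∀ x, Conn G (B x)
  sub : ∀ x, B x ⊆ U
  rich : ∀ x, F (B x)
  disj : ∀ x y, x ≠ y → Disjoint (B x) (B y)
  edge : ∀ x y, X.Adj x y → Touch G (B x) (B y)

def Contains {W : Type u} {V : Type v} (X : SimpleGraph W) (G : SimpleGraph V)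
    (F : Set V → Prop) (U : Set V) : Prop := ∃ B, Model X G F U B

/-- `U` contains a model of the graph obtained from `Y` by adding a universal vertex, where only
the branch sets of `Y` are required to satisfy `F`. -/
def Apex {W : Type u} {V : Type v} (Y : SimpleGraph W) (G : SimpleGraph V)
    (F : Set V → Prop) (U : Set V) : Prop :=
  ∃ D ⊆ U, Conn G D ∧ Contains Y G (fun K => F K ∧ Touch G K D) (U \ D)

def UpClosed {V : Type v} (F : Set V → Prop) : Prop := ∀ A B, A ⊆ B → F A → F B

/-- Families without rich models of `X` have transversals with weak coloring numbers `O(k g(r))`. -/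
def Hit (g : ℕ → ℕ) {W : Type u} (X : SimpleGraph W) : Prop :=
  ∃ c : ℕ, ∀ (V : Type v) [Finite V] (G : SimpleGraph V) (k : ℕ), Helly G k →
    ∀ U, Conn G U → ∀ F, UpClosed F → ¬ Contains X G F U →
      Solvable G U U F 2 (fun r => c * k * g r)

def ApexHit (g : ℕ → ℕ) {W : Type u} (X : SimpleGraph W) : Prop :=
  ∃ c : ℕ, ∀ (V : Type v) [Finite V] (G : SimpleGraph V) (k : ℕ), Helly G k →
    ∀ U, Conn G U → ∀ F, UpClosed F → ¬ Apex X G F U →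
      Solvable G U U F 2 (fun r => c * k * g r)

variable {W : Type u} {W' : Type u'} {V : Type v} {X : SimpleGraph W} {X' : SimpleGraph W'}
  {G : SimpleGraph V} {F : Set V → Prop} {U U' : Set V} {g : ℕ → ℕ}

theorem Model.comp {B : W' → Set V} (h : Model X' G F U B) (f : W → W')
    (hf : Function.Injective f) (he : ∀ x y, X.Adj x y → X'.Adj (f x) (f y)) :
    Model X G F U (B ∘ f) :=
  ⟨fun _ => h.conn _, fun _ => h.sub _, fun _ => h.rich _,
    fun _ _ hxy => h.disj _ _ (hf.ne hxy), fun x y hxy => h.edge _ _ (he x y hxy)⟩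

theorem Contains.comp (h : Contains X' G F U) (f : W → W')
    (hf : Function.Injective f) (he : ∀ x y, X.Adj x y → X'.Adj (f x) (f y)) :
    Contains X G F U :=
  h.imp' (· ∘ f) fun _ hB => hB.comp f hf he

theorem Apex.comp (h : Apex X' G F U) (f : W → W')
    (hf : Function.Injective f) (he : ∀ x y, X.Adj x y → X'.Adj (f x) (f y)) :
    Apex X G F U := by
  obtain ⟨D, hD, hc, h⟩ := h
  exact ⟨D, hD, hc, h.comp f hf he⟩

theorem Contains.mono (h : Contains X G F U) (hU : U ⊆ U') : Contains X G F U' :=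
  h.imp fun _ hB => ⟨hB.conn, fun x => (hB.sub x).trans hU, hB.rich, hB.disj, hB.edge⟩

theorem Apex.mono (h : Apex X G F U) (hU : U ⊆ U') : Apex X G F U' := by
  obtain ⟨D, hD, hc, h⟩ := h
  exact ⟨D, hD.trans hU, hc, h.mono (Set.sdiff_subset_sdiff_left hU)⟩

theorem Contains.of_isEmpty [IsEmpty W] : Contains X G F U :=
  ⟨fun _ => ∅, isEmptyElim, isEmptyElim, isEmptyElim, isEmptyElim, isEmptyElim⟩

theorem Hit.of_isEmpty [IsEmpty W] : Hit.{u, v} g X :=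
  ⟨0, fun _ _ _ _ _ _ _ _ _ h => (h Contains.of_isEmpty).elim⟩

theorem Hit.of_subsingleton [Subsingleton W] : Hit.{u, v} g X := by
  refine ⟨0, fun V _ G k _ U hU F _ h => Solvable.of_free hU fun K hK hc hF => h ?_⟩
  exact ⟨fun _ => K, fun _ => hc, fun _ => hK, fun _ => hF,
    fun x y hxy => (hxy (Subsingleton.elim x y)).elim,
    fun x y hxy => (hxy.ne (Subsingleton.elim x y)).elim⟩

theorem Hit.comp (h : Hit.{u', v} g X') (f : W → W')
    (hf : Function.Injective f) (he : ∀ x y, X.Adj x y → X'.Adj (f x) (f y)) :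
    Hit.{u, v} g X :=
  h.imp fun _ h V _ G k hk U hU F hF hX => h V G k hk U hU F hF fun hX' => hX (hX'.comp f hf he)

theorem ApexHit.comp (h : ApexHit.{u', v} g X') (f : W → W')
    (hf : Function.Injective f) (he : ∀ x y, X.Adj x y → X'.Adj (f x) (f y)) :
    ApexHit.{u, v} g X :=
  h.imp fun _ h V _ G k hk U hU F hF hX => h V G k hk U hU F hF fun hX' => hX (hX'.comp f hf he)

/-- Two disjoint sets that each contain rich models of both graphs would give a rich model of the
disjoint union. After deleting a transversal, every component lacks one of the two graphs and the
corresponding hypothesis applies. -/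
theorem Hit.sum (hg : ∀ r, 2 ≤ r → 1 ≤ g r) (h : Hit.{u, v} g X) (h' : Hit.{u', v} g X') :
    Hit.{max u u', v} g (X ⊕g X') := by
  obtain ⟨c, h⟩ := h
  obtain ⟨c', h'⟩ := h'
  refine ⟨c + c' + 65, fun V _ G k hk U hU F hF hX => ?_⟩
  have key : Solvable G U U F 2 (fun r => k + (c + c') * k * g r + 64 * k) := by
    refine Solvable.of_intersecting hk hU (fun A => Contains X G F A ∧ Contains X' G F A)
      (fun A hA B hB _ _ hPA hPB hd => hX ?_) fun C hC hCc hPC => ?_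
    · obtain ⟨M, hM⟩ := hPA.1
      obtain ⟨N, hN⟩ := hPB.2
      have hMN : ∀ x y, Disjoint (M x) (N y) := fun x y => hd.mono (hM.sub x) (hN.sub y)
      refine ⟨Sum.elim M N, ?_, ?_, ?_, ?_, ?_⟩
      · rintro (x | x)
        exacts [hM.conn x, hN.conn x]
      · rintro (x | x)
        exacts [(hM.sub x).trans hA, (hN.sub x).trans hB]
      · rintro (x | x)
        exacts [hM.rich x, hN.rich x]
      · rintro (x | x) (y | y) hxy
        · exact hM.disj x y fun h => hxy (by rw [h])
        · exact hMN x y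
        · exact (hMN y x).symm
        · exact hN.disj x y fun h => hxy (by rw [h])
      · rintro (x | x) (y | y) hxy
        · exact hM.edge x y (by simpa using hxy)
        · simp at hxy
        · simp at hxy
        · exact hN.edge x y (by simpa using hxy)
    · rcases not_and_or.1 hPC with hn | hn
      · exact (h V G k hk C hCc F hF hn).mono fun r _ => by gcongr; omega
      · exact (h' V G k hk C hCc F hF hn).mono fun r _ => by gcongr; omega
  refine key.mono fun r hr => ?_
  nlinarith [Nat.le_mul_of_pos_right k (hg r hr)]

/-- The disjoint union of `m` copies of a graph. -/
abbrev copies (m : ℕ) (X : SimpleGraph W) : SimpleGraph (Fin m × W) := (⊥ : SimpleGraph (Fin m)) □ X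

theorem copies_adj {m : ℕ} {p q : Fin m × W} :
    (copies m X).Adj p q ↔ X.Adj p.2 q.2 ∧ p.1 = q.1 := by
  simp [copies, SimpleGraph.boxProd_adj]

theorem Hit.copies (hg : ∀ r, 2 ≤ r → 1 ≤ g r) (h : Hit.{u, v} g X) (m : ℕ) :
    Hit.{u, v} g (copies m X) := by
  induction m with
  | zero => exact Hit.of_isEmpty
  | succ m ih =>
    refine (h.sum hg ih).comp
      (fun p : Fin (m + 1) × W => Fin.cases (Sum.inl p.2) (fun j => Sum.inr (j, p.2)) p.1) ?_ ?_
    · rintro ⟨i, x⟩ ⟨j, y⟩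
      refine Fin.cases ?_ (fun i => ?_) i <;> refine Fin.cases ?_ (fun j => ?_) j <;> simp
    · rintro ⟨i, x⟩ ⟨j, y⟩
      rw [copies_adj]
      rintro ⟨hxy, rfl⟩
      refine Fin.cases ?_ (fun i => ?_) i
      · simpa using hxy
      · simpa using hxy

/-- Adjacency in the graph obtained from disjoint `A` and `Y` by making `a` complete to `Y`. -/
def AttachAdj (A : SimpleGraph W) (a : W) (Y : SimpleGraph W') : W ⊕ W' → W ⊕ W' → Prop
  | .inl x, .inl y => A.Adj x y
  | .inr x, .inr y => Y.Adj x y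
  | .inl x, .inr _ => x = a
  | .inr _, .inl y => y = a

theorem Apex.rich (hF : UpClosed F) [Nonempty W] (h : Apex X G F U) : F U := by
  obtain ⟨D, -, -, B, hB⟩ := h
  obtain ⟨x⟩ := ‹Nonempty W›
  exact hF _ _ ((hB.sub x).trans Set.sdiff_subset) (hB.rich x).1

/-- The hub and the leaves of an apex model in a connected set can be extended so that they
cover it. -/
theorem Apex.exists_cover [Finite V] (hF : UpClosed F) (hU : Pre G U) (h : Apex X G F U) :
    ∃ (D : Set V) (B : W → Set V), Conn G D ∧ Model X G F U B ∧ (∀ x, Touch G (B x) D) ∧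
      (∀ x, Disjoint (B x) D) ∧ D ∪ (⋃ x, B x) = U := by
  obtain ⟨D, hDU, hD, B, hB⟩ := h
  obtain ⟨T, hT, hle, hTU, hTd⟩ := hU.exists_absorb (ι := Option W) (fun o => o.elim D B)
    (by rintro (_ | x); exacts [hD, hB.conn x])
    (by rintro (_ | x); exacts [hDU, (hB.sub x).trans Set.sdiff_subset])
    (by
      have hDB : ∀ x, Disjoint (B x) D := fun x =>
        Set.disjoint_left.2 fun y hy => (hB.sub x hy).2
      rintro (_ | x) (_ | y) hxy
      · exact (hxy rfl).elim
      · exact (hDB y).symm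
      · exact hDB x
      · exact hB.disj x y fun h => hxy (by rw [h]))
  have hsub : ∀ o, T o ⊆ U := fun o => (Set.subset_iUnion T o).trans hTU.subset
  refine ⟨T none, fun x => T (some x), hT _, ⟨fun x => hT _, fun x => hsub _,
    fun x => hF _ _ (hle (some x)) (hB.rich x).1, fun x y hxy => hTd _ _ (by simpa using hxy),
    fun x y hxy => (hB.edge x y hxy).mono (hle (some x)) (hle (some y))⟩,
    fun x => (hB.rich x).2.mono (hle (some x)) (hle none), fun x => hTd _ _ (by simp), ?_⟩
  rw [← hTU]
  ext x
  simp [Option.exists]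

/-- Rich models of `A` in which each branch set contains copies of `Y` joined to a hub give
rich models of `A` with `Y` attached to a vertex. -/
theorem Contains.attach [Finite V] {W'' : Type u''} {Z : SimpleGraph W''} [Fintype W] [Nonempty W']
    {A : SimpleGraph W} {Y : SimpleGraph W'}
    (a : W) (hF : UpClosed F) (f : W'' → W ⊕ W') (hf : Function.Injective f)
    (he : ∀ x y, Z.Adj x y → AttachAdj A a Y (f x) (f y))
    (h : Contains A G (fun K => Apex (copies (Fintype.card W + 1) Y) G F K) U) :
    Contains Z G F U := by
  classical
  obtain ⟨B, hB⟩ := h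
  obtain ⟨D, T, hD, hT, hTD, hTd, hcov⟩ := (hB.rich a).exists_cover hF (hB.conn a).2
  -- a copy of `Y` that avoids the chosen edges between `B a` and the other branch sets
  have : Nonempty V := ⟨(hB.conn a).1.some⟩
  choose! s hs t ht hst using fun x (hx : A.Adj a x) => hB.edge a x hx
  obtain ⟨i, hi⟩ : ∃ i, ∀ x, A.Adj a x → ∀ y, s x ∉ T (i, y) := by
    -- The copies are disjoint, so each point `s x` spoils at most one of them; there are more
    -- copies than vertices of `A`.
    by_contra! hcon
    choose x hx y hy using hcon
    have hinj : Function.Injective x := by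
      intro i j hij
      by_contra hne
      have := hT.disj (i, y i) (j, y j) (fun h => hne (congrArg Prod.fst h))
      refine this.le_bot ⟨hy i, ?_⟩
      rw [hij]; exact hy j
    have := Fintype.card_le_of_injective x hinj
    simp at this
  have hpos : 0 < Fintype.card W := Fintype.card_pos_iff.2 ⟨a⟩
  -- The copy `j` goes into the new branch set `H` of `a` and makes it rich.
  obtain ⟨j, hij⟩ : ∃ j : Fin (Fintype.card W + 1), j ≠ i := by
    have : Nontrivial (Fin (Fintype.card W + 1)) := Fin.nontrivial_iff_two_le.2 (by omega)
    exact exists_ne i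
  obtain ⟨y₀⟩ := ‹Nonempty W'›
  -- Since the hub and the copies cover `B a`, absorbing all copies except the `i`-th keeps the
  -- chosen edges to the other branch sets.
  let H : Set V := D ∪ ⋃ p : {p : Fin (Fintype.card W + 1) × W' // p.1 ≠ i}, T p.1
  have hH : Conn G H := hD.biUnion_hub _ (fun p => (hT.conn p.1).2) fun p => hTD p.1
  have hHa : H ⊆ B a := by
    rw [← hcov]
    exact Set.union_subset_union_right _ (Set.iUnion_subset fun p => Set.subset_iUnion T p.1)
  have hHT : ∀ y, Disjoint H (T (i, y)) := by
    intro y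
    rw [Set.disjoint_union_left, Set.disjoint_iUnion_left]
    exact ⟨(hTd _).symm, fun p => hT.disj _ _ fun h => p.2 (congrArg Prod.fst h)⟩
  have hsH : ∀ x, A.Adj a x → s x ∈ H := by
    intro x hx
    rcases hcov.symm.subset (hs x hx) with h | h
    · exact Or.inl h
    · obtain ⟨p, hp⟩ := Set.mem_iUnion.1 h
      refine Or.inr (Set.mem_iUnion.2 ⟨⟨p, ?_⟩, hp⟩)
      rintro rfl
      exact hi x hx p.2 hp
  let N : W ⊕ W' → Set V :=
    Sum.elim (fun x => if x = a then H else B x) (fun y => T (i, y))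
  have hNa : N (.inl a) = H := if_pos rfl
  have hNr : ∀ y, N (.inr y) = T (i, y) := fun _ => rfl
  have hNx : ∀ x, x ≠ a → N (.inl x) = B x := fun x hx => if_neg hx
  have hNle : ∀ x, N (.inl x) ⊆ B x := by
    intro x
    by_cases hx : x = a
    · subst hx; rw [hNa]; exact hHa
    · rw [hNx x hx]
  have hdis : ∀ x y, Disjoint (N (.inl x)) (N (.inr y)) := by
    intro x y
    by_cases hx : x = a
    · subst hx; rw [hNa]; exact hHT y
    · exact (hB.disj x a hx).mono (hNle x) (hT.sub _)
  have hTH : ∀ y, Touch G H (N (.inr y)) := fun y =>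
    (hTD (i, y)).symm.mono Set.subset_union_left subset_rfl
  have haedge : ∀ x, A.Adj a x → Touch G H (N (.inl x)) := by
    intro x hx
    rw [hNx x hx.ne']
    exact ⟨s x, hsH x hx, t x, ht x hx, hst x hx⟩
  refine ⟨N ∘ f, fun z => ?_, fun z => ?_, fun z => ?_, fun z w hzw => ?_, fun z w hzw => ?_⟩
  · rcases hz : f z with x | y
    · by_cases hx : x = a
      · subst hx; simpa only [Function.comp, hz, hNa] using hH
      · simpa only [Function.comp, hz, hNx x hx] using hB.conn x
    · simpa only [Function.comp, hz, hNr] using hT.conn (i, y)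
  · rcases hz : f z with x | y
    · simpa only [Function.comp, hz] using (hNle x).trans (hB.sub x)
    · simpa only [Function.comp, hz, hNr] using (hT.sub (i, y)).trans (hB.sub a)
  · rcases hz : f z with x | y
    · by_cases hx : x = a
      · subst hx
        simp only [Function.comp, hz, hNa]
        refine hF _ _ ?_ (hT.rich (j, y₀))
        exact (Set.subset_iUnion (fun p : {p : Fin (Fintype.card W + 1) × W' // p.1 ≠ i} => T p.1)
          ⟨(j, y₀), hij⟩).trans Set.subset_union_right
      · simp only [Function.comp, hz, hNx x hx]
        have : Nonempty W' := ⟨y₀⟩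
        exact (hB.rich x).rich hF
    · simpa only [Function.comp, hz, hNr] using hT.rich (i, y)
  · have hne := hf.ne hzw
    simp only [Function.comp]
    rcases hz : f z with x | x <;> rcases hw : f w with y | y
    · exact (hB.disj x y fun h => hne (by rw [hz, hw, h])).mono (hNle x) (hNle y)
    · exact hdis x y
    · exact (hdis y x).symm
    · exact hT.disj _ _ fun h => hne (by rw [hz, hw]; exact congrArg _ (Prod.ext_iff.1 h).2)
  · have hadj := he z w hzw
    simp only [Function.comp]
    rcases hz : f z with x | x <;> rcases hw : f w with y | y <;> rw [hz, hw] at hadj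
    · have hadj : A.Adj x y := hadj
      by_cases hx : x = a
      · subst hx; rw [hNa]; exact haedge y hadj
      · by_cases hy : y = a
        · subst hy; rw [hNa]; exact (haedge x hadj.symm).symm
        · rw [hNx x hx, hNx y hy]; exact hB.edge x y hadj
    · have hadj : x = a := hadj
      subst hadj; rw [hNa]; exact hTH y
    · have hadj : y = a := hadj
      subst hadj; rw [hNa]; exact (hTH x).symm
    · exact hT.edge _ _ (copies_adj.2 ⟨hadj, rfl⟩)

/-- The hypothesis on `A` is used for the family of sets that contain `Apex` models of the copies of
`Y`: by `Contains.attach` it has no rich model of `A`. In the remaining components there is no such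
`Apex` model, so the hypothesis on `Y` finishes. -/
theorem Hit.attach {W'' : Type u''} {Z : SimpleGraph W''} [Fintype W] [Nonempty W']
    {A : SimpleGraph W} {Y : SimpleGraph W'} (hg : ∀ r, 2 ≤ r → 1 ≤ g r) (hA : Hit.{u, v} g A)
    (hY : ApexHit.{u', v} g (WeakColoring.copies (Fintype.card W + 1) Y)) (a : W)
    (f : W'' → W ⊕ W') (hf : Function.Injective f)
    (he : ∀ x y, Z.Adj x y → AttachAdj A a Y (f x) (f y)) : Hit.{u'', v} g Z := by
  obtain ⟨c, hA⟩ := hA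
  obtain ⟨c', hY⟩ := hY
  refine ⟨c + c' + 64, fun V _ G k hk U hU F hF hZ => ?_⟩
  have h1 := hA V G k hk U hU (fun K => Apex (WeakColoring.copies (Fintype.card W + 1) Y) G F K)
    (fun A B hAB h => h.mono hAB) fun h => hZ (h.attach a hF f hf he)
  obtain ⟨S, hS, hSF, hSH, hSW⟩ := h1.bind hk hU (F := F) fun C hC hCc hn _ =>
    hY V G k hk C hCc F hF hn
  refine ⟨S, hS, fun K hK hc => (hSF K hK hc).2, hSH, fun r hr => (hSW r hr).mono ?_⟩
  nlinarith [Nat.le_mul_of_pos_right k (hg r hr)]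

end Models

/-! ### From `Hit` to `ApexHit` at the cost of a factor `r` -/

section Layers

variable {V : Type v} {G : SimpleGraph V}

theorem ncard_le_of_layers [Finite V] {A : Set V} {n : ℕ} (l : V → ℕ) (I : Finset ℕ)
    (hI : ∀ v ∈ A, l v ∈ I) (hn : ∀ i, {v ∈ A | l v = i}.ncard ≤ n) : A.ncard ≤ I.card * n := by
  have hsub : A ⊆ ⋃ i : I, {v ∈ A | l v = i} := fun v hv =>
    Set.mem_iUnion.2 ⟨⟨l v, hI v hv⟩, hv, rfl⟩
  refine (Set.ncard_le_ncard hsub (Set.toFinite _)).trans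
    ((Set.ncard_iUnion_le_of_fintype _).trans ?_)
  refine (Finset.sum_le_card_nsmul _ _ n fun (i : I) _ => hn i).trans ?_
  simp

theorem le_add_length {C : Set V} {l : V → ℕ}
    (hl : ∀ x ∈ C, ∀ y ∈ C, G.Adj x y → l x ≤ l y + 1) {u v : V} (p : G.Walk u v)
    (hp : ∀ x ∈ p.support, x ∈ C) : l u ≤ l v + p.length := by
  induction p with
  | nil => simp
  | cons h p ih =>
    simp only [SimpleGraph.Walk.support_cons, List.mem_cons, forall_eq_or_imp] at hp
    have := ih hp.2
    have := hl _ hp.1 _ (hp.2 _ p.start_mem_support) h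
    rw [SimpleGraph.Walk.length_cons]
    omega

/-- A set `S ⊆ C`, with layers given by `l`, that solves the problem in a set `C` with at most two
hubs, such that a vertex weakly reaches few vertices of each layer, and none in later layers than
its own. -/
def Layered (G : SimpleGraph V) (U C : Set V) (F : Set V → Prop) (n : ℕ → ℕ) (S : Set V)
    (l : V → ℕ) : Prop :=
  S ⊆ C ∧ (∀ K ⊆ C \ S, Conn G K → ¬ F K) ∧ (∀ D, IsComp G (C \ S) D → Hub G U D 4) ∧
  (∀ x ∈ C, ∀ y ∈ C, G.Adj x y → l x ≤ l y + 1) ∧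
  (∀ x ∈ C, ∀ y ∈ U, y ∉ C → G.Adj x y → l x = 0) ∧
  ∀ r, 2 ≤ r → ∃ σ : V → ℕ, ∀ u ∈ C, (∀ v ∈ wr G r C S σ u, l v ≤ l u) ∧
    ∀ i, {v ∈ wr G r C S σ u | l v = i}.ncard ≤ n r

/-- The set `S₁` from `hstep` is the layer `0`. Each rich component `D` of `C \ S₁` no longer
touches `U \ C`, so its hubs in `C` extend to the same number of hubs in `U` and the recursion
continues in `D`. The layers obtained there are shifted by one; poor components are left alone. -/
theorem exists_layered [Finite V] {U : Set V} (hU : Pre G U) {F : Set V → Prop}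
    (hF : UpClosed F) (n : ℕ → ℕ)
    (hstep : ∀ C ⊆ U, Conn G C → Hub G U C 2 → ∃ S ⊆ C,
      (∀ K ⊆ C \ S, Conn G K → F K → ¬ Touch G K (U \ C)) ∧
      (∀ D, IsComp G (C \ S) D → Hub G C D 2) ∧ ∀ r, 2 ≤ r → WC G r C S (n r))
    {C : Set V} (hCU : C ⊆ U) (hC : Conn G C) (hne : (U \ C).Nonempty) (hH : Hub G U C 2) :
    ∃ S l, Layered G U C F n S l := by
  classical
  induction hm : C.ncard using Nat.strong_induction_on generalizing C with
  | _ m ih =>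
  obtain ⟨S₁, hS₁, hS₁F, hS₁H, hS₁W⟩ := hstep C hCU hC hH
  let R : Set V → Prop := fun D => IsComp G (C \ S₁) D ∧ F D
  have hRC : ∀ D, R D → D ⊆ C := fun D hD => hD.1.sub.trans Set.sdiff_subset
  have hRt : ∀ D, R D → ¬ Touch G D (U \ C) := fun D hD => hS₁F D hD.1.sub hD.1.conn hD.2
  have hrec : ∀ D, R D → ∃ S l, Layered G U D F n S l := by
    intro D hD
    have hDC : D ≠ C := by
      rintro rfl
      exact hRt D hD (hU.touch_diff hCU hC.1 hne)
    refine ih _ ?_ ((hRC D hD).trans hCU) hD.1.conn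
      (hne.mono (Set.sdiff_subset_sdiff_right (hRC D hD)))
      ((hS₁H D hD.1).of_not_touch hU hCU (hRC D hD) hD.1.conn (hRt D hD)) rfl
    rw [← hm]
    exact Set.ncard_lt_ncard ((hRC D hD).ssubset_of_ne hDC) (Set.toFinite _)
  choose! S l hSC hSF hSH hlip hbd hord using hrec
  have huniq : ∀ D E, R D → R E → ∀ x ∈ D, x ∈ E → D = E := fun D E hD hE x hx hx' =>
    hD.1.eq_of_inter hE.1 ⟨x, hx, hx'⟩
  let T : Set V := ⋃ D : {D // R D}, S D.1
  have hTsub : T ⊆ C \ S₁ := Set.iUnion_subset fun D => (hSC D.1 D.2).trans D.2.1.sub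
  have hTD : ∀ D, R D → T ∩ D = S D := by
    intro D hD
    ext x
    constructor
    · rintro ⟨hx, hxD⟩
      obtain ⟨E, hE⟩ := Set.mem_iUnion.1 hx
      rwa [← huniq E.1 D E.2 hD x (hSC E.1 E.2 hE) hxD]
    · exact fun hx => ⟨Set.mem_iUnion.2 ⟨⟨D, hD⟩, hx⟩, hSC D hD hx⟩
  have hTR : ∀ x ∈ T, ∀ D, IsComp G (C \ S₁) D → x ∈ D → R D := by
    intro x hx D hD hxD
    obtain ⟨E, hE⟩ := Set.mem_iUnion.1 hx
    rw [hD.eq_of_inter E.2.1 ⟨x, hxD, hSC E.1 E.2 hE⟩]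
    exact E.2
  let l' : V → ℕ := fun x => if h : ∃ D, R D ∧ x ∈ D then l h.choose x + 1 else 0
  have hl1 : ∀ D, R D → ∀ x ∈ D, l' x = l D x + 1 := by
    intro D hD x hx
    have h : ∃ D, R D ∧ x ∈ D := ⟨D, hD, hx⟩
    simp only [l', dif_pos h]
    rw [huniq _ D h.choose_spec.1 hD x h.choose_spec.2 hx]
  have hl0 : ∀ x, (∀ D, R D → x ∉ D) → l' x = 0 := by
    intro x hx
    have h : ¬ ∃ D, R D ∧ x ∈ D := fun ⟨D, hD, hxD⟩ => hx D hD hxD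
    simp only [l', dif_neg h]
  have hlS : ∀ x ∈ S₁, l' x = 0 := fun x hx => hl0 x fun D hD hxD => (hD.1.sub hxD).2 hx
  have hin : ∀ K ⊆ C \ (S₁ ∪ T), Conn G K → ∃ D, IsComp G (C \ S₁) D ∧ K ⊆ D := by
    intro K hK hc
    exact hc.2.exists_isComp (fun x hx => ⟨(hK hx).1, fun h => (hK hx).2 (Or.inl h)⟩) hc.1
  refine ⟨S₁ ∪ T, l', Set.union_subset hS₁ (hTsub.trans Set.sdiff_subset), ?_, ?_, ?_, ?_, ?_⟩
  · intro K hK hc hFK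
    obtain ⟨D, hD, hKD⟩ := hin K hK hc
    have hRD : R D := ⟨hD, hF _ _ hKD hFK⟩
    exact hSF D hRD K (fun x hx => ⟨hKD hx, fun h =>
      (hK hx).2 (Or.inr ((hTD D hRD).symm.subset h).1)⟩) hc hFK
  · intro E hE
    obtain ⟨D, hD, hED⟩ := hin E hE.sub hE.conn
    by_cases hRD : R D
    · refine hSH D hRD E ⟨fun x hx => ⟨hED hx, fun h =>
        (hE.sub hx).2 (Or.inr ((hTD D hRD).symm.subset h).1)⟩, hE.conn, ?_⟩
      intro x hx y hy hadj
      refine hE.closed x hx y ⟨hRC D hRD hy.1, ?_⟩ hadj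
      rintro (h | h)
      · exact (hD.sub hy.1).2 h
      · exact hy.2 ((hTD D hRD).subset ⟨h, hy.1⟩)
    · have hDE : D ⊆ E := by
        refine hE.subset_of_inter hD.conn.2 (fun x hx => ⟨(hD.sub hx).1, ?_⟩) ?_
        · rintro (h | h)
          · exact (hD.sub hx).2 h
          · exact hRD (hTR x h D hD hx)
        · rw [Set.inter_eq_right.2 hED]; exact hE.conn.1
      rw [hED.antisymm hDE]
      -- A poor component is final and is not restored to two hubs: it has two in `C`, besides the
      -- two of `C` in `U`.
      exact hH.add hCU (hD.sub.trans Set.sdiff_subset) (hS₁H D hD)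
  · intro x hx y hy hadj
    by_cases h : ∃ D, R D ∧ x ∈ D
    · obtain ⟨D, hD, hxD⟩ := h
      rw [hl1 D hD x hxD]
      by_cases hyD : y ∈ D
      · rw [hl1 D hD y hyD]
        exact Nat.succ_le_succ (hlip D hD x hxD y hyD hadj)
      -- An edge leaving `D` starts in the layer `0` of `D`, which has index `1` after the shift.
      · rw [hbd D hD x hxD y (hCU hy) hyD hadj]
        omega
    · rw [hl0 x fun D hD hxD => h ⟨D, hD, hxD⟩]
      exact Nat.zero_le _
  · intro x hx y hy hyC hadj
    exact hl0 x fun D hD hxD => hRt D hD ⟨x, hxD, y, ⟨hy, hyC⟩, hadj⟩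
  · intro r hr
    obtain ⟨σ₁, hσ₁⟩ := hS₁W r hr
    choose! σ₂ hσ₂ using fun D hD => hord D hD r hr
    obtain ⟨σ, hσ⟩ := exists_rank_compose (G := G) hTsub σ₁ σ₂
    have hσ' : ∀ u, ∀ v ∈ wr G r C (S₁ ∪ T) σ u, v ∈ wr G r C S₁ σ₁ u ∨
        ∃ D, R D ∧ u ∈ D ∧ v ∈ wr G r D (S D) (σ₂ D) u := by
      intro u v hv
      rcases hσ r u v hv with h | ⟨D, hD, huD, h⟩
      · exact Or.inl h
      · have hRD := hTR v h.1.1 D hD h.1.2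
        rw [hTD D hRD] at h
        exact Or.inr ⟨D, hRD, huD, h⟩
    refine ⟨σ, fun u hu => ⟨fun v hv => ?_, fun i => ?_⟩⟩
    · rcases hσ' u v hv with h | ⟨D, hD, huD, h⟩
      · rw [hlS v h.1]; exact Nat.zero_le _
      · rw [hl1 D hD v (hSC D hD h.1), hl1 D hD u huD]
        exact Nat.succ_le_succ ((hσ₂ D hD u huD).1 v h)
    · rcases i with _ | i
      · refine (Set.ncard_le_ncard ?_ (Set.toFinite _)).trans (hσ₁ u hu)
        rintro v ⟨hv, hvl⟩
        rcases hσ' u v hv with h | ⟨D, hD, huD, h⟩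
        · exact h
        · rw [hl1 D hD v (hSC D hD h.1)] at hvl
          omega
      · by_cases hex : ∃ D, R D ∧ u ∈ D
        · obtain ⟨D, hD, huD⟩ := hex
          refine (Set.ncard_le_ncard ?_ (Set.toFinite _)).trans ((hσ₂ D hD u huD).2 i)
          rintro v ⟨hv, hvl⟩
          rcases hσ' u v hv with h | ⟨E, hE, huE, h⟩
          · rw [hlS v h.1] at hvl
            omega
          · obtain rfl := huniq E D hE hD u huE huD
            rw [hl1 E hE v (hSC E hE h.1)] at hvl
            exact ⟨h, Nat.succ_injective hvl⟩
        · have : {v ∈ wr G r C (S₁ ∪ T) σ u | l' v = i + 1} = ∅ := by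
            ext v
            simp only [Set.mem_ofPred_eq, Set.mem_empty_iff_false, iff_false, not_and]
            intro hv hvl
            rcases hσ' u v hv with h | ⟨D, hD, huD, h⟩
            · rw [hlS v h.1] at hvl
              omega
            · exact hex ⟨D, hD, huD⟩
          rw [this, Set.ncard_empty]
          exact Nat.zero_le _

/-- Along a walk of length at most `r` the layer drops by at most `r`, and no later layer is weakly
reachable. This leaves `r + 1` layers. -/
theorem Layered.solvable [Finite V] {U C S : Set V} {F : Set V → Prop} {n : ℕ → ℕ} {l : V → ℕ}
    (h : Layered G U C F n S l) : Solvable G U C F 4 (fun r => (r + 1) * n r) := by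
  obtain ⟨hS, hF, hH, hl, -, hord⟩ := h
  refine ⟨S, hS, hF, hH, fun r hr => ?_⟩
  obtain ⟨σ, hσ⟩ := hord r hr
  refine ⟨σ, fun u hu => ?_⟩
  refine (ncard_le_of_layers l (Finset.Icc (l u - r) (l u)) (fun v hv => ?_)
    (hσ u hu).2).trans (Nat.mul_le_mul_right _ ?_)
  · obtain ⟨-, p, hpr, hp, -⟩ := id hv
    have := le_add_length hl p hp
    have := (hσ u hu).1 v hv
    rw [Finset.mem_Icc]
    omega
  · rw [Nat.card_Icc]
    omega

theorem Hit.apexHit {W : Type u} [Nonempty W] {Y : SimpleGraph W} {g : ℕ → ℕ}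
    (hg : ∀ r, 2 ≤ r → 1 ≤ g r) (h : Hit.{u, v} g Y) :
    ApexHit.{u, v} (fun r => r * g r) Y := by
  obtain ⟨c, h⟩ := h
  -- `4 * c + 128` comes from `(r + 1) * n r` with `r + 1 ≤ 2 * r`; the first transversal adds `1`
  -- and the reduction from four hubs to two adds `64`.
  refine ⟨4 * c + 193, fun V _ G k hk U hU F hF hY => ?_⟩
  let n : ℕ → ℕ := fun r => c * k * g r + c * k * g r + 64 * k
  have hno : ∀ C ⊆ U, ∀ P, Pre G P → P ⊆ U \ C →
      ¬ Contains Y G (fun K => F K ∧ Touch G K P) C := by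
    rintro C hC P hP hPU ⟨B, hB⟩
    refine hY ⟨P, hPU.trans Set.sdiff_subset, ⟨?_, hP⟩, Contains.mono ⟨B, hB⟩ fun x hx =>
      ⟨hC hx, fun hxP => (hPU hxP).2 hx⟩⟩
    obtain ⟨x⟩ := ‹Nonempty W›
    obtain ⟨-, -, y, hy, -⟩ := (hB.rich x).2
    exact ⟨y, hy⟩
  have hup : ∀ P, UpClosed (fun K => F K ∧ Touch G K P) := fun P A B hAB hA =>
    ⟨hF A B hAB hA.1, hA.2.mono hAB subset_rfl⟩
  have hstep : ∀ C ⊆ U, Conn G C → Hub G U C 2 → ∃ S ⊆ C,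
      (∀ K ⊆ C \ S, Conn G K → F K → ¬ Touch G K (U \ C)) ∧
      (∀ D, IsComp G (C \ S) D → Hub G C D 2) ∧ ∀ r, 2 ≤ r → WC G r C S (n r) := by
    intro C hCU hC hH
    obtain ⟨P, Q, hP, hQ, hPQ⟩ := hH.pair
    have hPs : P ⊆ U \ C := Set.subset_union_left.trans hPQ.subset
    have hQs : Q ⊆ U \ C := Set.subset_union_right.trans hPQ.subset
    obtain ⟨S, hS, hSF, hSH, hSW⟩ := Solvable.bind hk hC
      (h V G k hk C hC _ (hup P) (hno C hCU P hP hPs)) (F := fun K => F K ∧ Touch G K Q)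
      fun D hDC hD _ _ => h V G k hk D hD _ (hup Q) (hno D (hDC.trans hCU) Q hQ
        (hQs.trans (Set.sdiff_subset_sdiff_right hDC)))
    refine ⟨S, hS, fun K hK hc hFK => ?_, hSH, hSW⟩
    rintro ⟨x, hx, y, hy, hadj⟩
    rcases hPQ.symm.subset hy with hy | hy
    · exact (hSF K hK hc).1 ⟨hFK, x, hx, y, hy, hadj⟩
    · exact (hSF K hK hc).2 ⟨hFK, x, hx, y, hy, hadj⟩
  obtain ⟨a, ha⟩ := hU.1
  -- The one-member family only serves to start the layering: for every component `C` of `U \ Z`,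
  -- the set `U \ C` is preconnected and contains `a`.
  obtain ⟨Z, hZU, hZ, hhit, hpre⟩ := hk.exists_transversal hU {{a}}
    (by rintro B rfl; exact ⟨⟨⟨a, rfl⟩, pre_singleton a⟩, Set.singleton_subset_iff.2 ha⟩)
    (by rintro A rfl B rfl; exact ⟨a, rfl, rfl⟩)
  have haZ : a ∈ Z := by
    obtain ⟨x, rfl, hx⟩ := hhit _ rfl
    exact hx
  have key : Solvable G U U F 4 (fun r => k + (r + 1) * n r) :=
    Solvable.compose hZU (fun r _ => WC.of_ncard_le hZ) fun C hC => by
      obtain ⟨S, l, hS⟩ := exists_layered hU.2 hF n hstep (hC.sub.trans Set.sdiff_subset) hC.conn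
        ⟨a, ha, fun h => (hC.sub h).2 haZ⟩ (Hub.of_pre (hpre C hC))
      exact hS.solvable
  refine (key.restore hk hU).mono fun r hr => ?_
  have h1 := hg r hr
  have hn : n r ≤ (2 * c + 64) * (k * g r) := by
    have : k ≤ k * g r := Nat.le_mul_of_pos_right k h1
    simp only [n]
    nlinarith
  have h2 : (r + 1) * n r ≤ (2 * r) * ((2 * c + 64) * (k * g r)) :=
    Nat.mul_le_mul (by omega) hn
  have h3 : k ≤ k * (r * g r) := Nat.le_mul_of_pos_right k (Nat.mul_pos (by omega) h1)
  calc k + (r + 1) * n r + 4 ^ 3 * k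
      ≤ k * (r * g r) + (2 * r) * ((2 * c + 64) * (k * g r)) + 4 ^ 3 * (k * (r * g r)) := by
        gcongr
    _ ≤ (4 * c + 193) * k * (r * g r) := by
        have : 0 ≤ k * (r * g r) := Nat.zero_le _
        nlinarith

end Layers

/-! ### The ruler sequence -/

section Ruler

/-- The exponent of `2` in `i + 1`, truncated at `L`. -/
def ruler (L i : ℕ) : ℕ := Nat.findGreatest (fun j => 2 ^ j ∣ i + 1) L

theorem ruler_le (L i : ℕ) : ruler L i ≤ L := Nat.findGreatest_le L

theorem two_pow_ruler_dvd (L i : ℕ) : 2 ^ ruler L i ∣ i + 1 :=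
  Nat.findGreatest_spec (P := fun j => 2 ^ j ∣ i + 1) (Nat.zero_le L) (by simp)

theorem le_ruler {L i j : ℕ} (hj : j ≤ L) (h : 2 ^ j ∣ i + 1) : j ≤ ruler L i :=
  Nat.le_findGreatest hj h

/-- If the common value `w` is below `L`, then `b + 1` and `b' + 1` are odd multiples of `2 ^ w`,
and the next multiple after `b + 1` is divisible by `2 ^ (w + 1)` and lies strictly between them. If
`w = L`, the two are at least `2 ^ L` apart. -/
theorem exists_ruler_lt {L b b' : ℕ} (hlt : b < b') (hL : b' - b < 2 ^ L)
    (h : ruler L b = ruler L b') : ∃ i, b < i ∧ i < b' ∧ ruler L b < ruler L i := by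
  obtain ⟨q, hq⟩ := two_pow_ruler_dvd L b
  obtain ⟨q', hq'⟩ := two_pow_ruler_dvd L b'
  rw [← h] at hq'
  set w := ruler L b with hw
  have hpos : 0 < 2 ^ w := by positivity
  have hqq : q < q' := by
    refine Nat.lt_of_mul_lt_mul_left (a := 2 ^ w) ?_
    omega
  have hwL : w < L := by
    refine lt_of_le_of_ne (ruler_le L b) fun hwL => ?_
    have : 2 ^ w * (q + 1) ≤ 2 ^ w * q' := Nat.mul_le_mul_left _ hqq
    rw [← hwL] at hL
    rw [Nat.mul_add] at this
    omega
  have hodd : ∀ p a, a + 1 = 2 ^ w * p → ruler L a = w → ¬ 2 ∣ p := by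
    rintro p a ha haw ⟨s, rfl⟩
    have := le_ruler (L := L) (i := a) (j := w + 1) hwL ⟨s, by rw [ha, pow_succ]; ring⟩
    omega
  have h1 := hodd q b hq hw.symm
  have h2 := hodd q' b' hq' h.symm
  have hqq' : q + 2 ≤ q' := by omega
  have h3 : 2 ^ w * (q + 2) ≤ 2 ^ w * q' := Nat.mul_le_mul_left _ hqq'
  rw [Nat.mul_add] at h3
  refine ⟨b + 2 ^ w, by omega, by omega, ?_⟩
  refine Nat.lt_of_succ_le (le_ruler hwL ?_)
  obtain ⟨s, hs⟩ : 2 ∣ q + 1 := by omega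
  refine ⟨s, ?_⟩
  have : b + 2 ^ w + 1 = 2 ^ w * (q + 1) := by rw [Nat.mul_add]; omega
  rw [this, hs, pow_succ]; ring

/-- Two elements with the same ruler value would have a larger value between them, so the ruler is
injective on `I`, with values in `{0, ..., L}`. -/
theorem card_records_le {L : ℕ} (I : Finset ℕ) (hI : ∀ b ∈ I, ∀ b' ∈ I, b' - b < 2 ^ L)
    (hrec : ∀ b ∈ I, ∀ b' ∈ I, ∀ i, b < i → i < b' →
      ruler L i ≤ ruler L b ∨ ruler L i ≤ ruler L b') : I.card ≤ L + 1 := by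
  have hinj : ∀ b ∈ I, ∀ b' ∈ I, b < b' → ruler L b ≠ ruler L b' := by
    intro b hb b' hb' hlt he
    obtain ⟨i, h1, h2, h3⟩ := exists_ruler_lt hlt (hI b hb b' hb') he
    have := hrec b hb b' hb' i h1 h2
    omega
  rw [← Finset.card_range (L + 1)]
  refine Finset.card_le_card_of_injOn (ruler L) (fun i _ => ?_) fun b hb b' hb' he => ?_
  · exact Finset.mem_coe.2 (Finset.mem_range.2 (Nat.lt_succ_of_le (ruler_le L i)))
  · rcases lt_trichotomy b b' with h | h | h
    · exact (hinj b hb b' hb' h he).elim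
    · exact h
    · exact (hinj b' hb' b hb h he.symm).elim

end Ruler

/-! ### Families without large stars: chains of separating layers and the bound `k log r` -/

section Chains

variable {V : Type v} {G : SimpleGraph V}

/-- A set `S ⊆ C` that solves the problem in `C`, with layers of size at most `k` that separate
earlier from later ones. -/
structure Chain (G : SimpleGraph V) (U C : Set V) (F : Set V → Prop) (k : ℕ) (S : Set V)
    (l : V → ℕ) : Prop where
  sub : S ⊆ C
  hit : ∀ K ⊆ C \ S, Conn G K → ¬ F K
  hub : ∀ D, IsComp G (C \ S) D → Hub G U D 2
  lip : ∀ x ∈ C, ∀ y ∈ C, G.Adj x y → l x ≤ l y + 1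
  sep : ∀ x ∈ C, ∀ y ∈ C, G.Adj x y → l y = l x + 1 → x ∈ S
  boundary : ∀ x ∈ C, ∀ y ∈ U, y ∉ C → G.Adj x y → l x = 0
  card : ∀ i, {v ∈ S | l v = i}.ncard ≤ k

/-- The walk has an edge from a layer at most `i` to a layer above `i`. Layers increase by at most
one along it, so its first end is in layer `i`, and in `S` by `Chain.sep`. -/
theorem Chain.exists_mem_support {U C S : Set V} {F : Set V → Prop} {k : ℕ} {l : V → ℕ}
    (h : Chain G U C F k S l) {u v : V} (p : G.Walk u v) (hp : ∀ x ∈ p.support, x ∈ C) {i : ℕ}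
    (hi : l u ≤ i ∧ i < l v) : ∃ x ∈ p.support, x ∈ S ∧ l x = i := by
  obtain ⟨d, hd, h1, h2⟩ := p.exists_boundary_dart {x | l x ≤ i} hi.1 (not_le.2 hi.2)
  have hf := p.dart_fst_mem_support_of_mem_darts hd
  have hs := p.dart_snd_mem_support_of_mem_darts hd
  have h1 : l d.fst ≤ i := h1
  have h2 : i < l d.snd := not_le.1 h2
  have h3 := h.lip _ (hp _ hs) _ (hp _ hf) d.adj.symm
  exact ⟨d.fst, hf, h.sep _ (hp _ hf) _ (hp _ hs) d.adj (by omega), by omega⟩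

/-- A walk from `u` to `v` meets `S` in every layer between theirs, on the side of `u`. If `v` is
its minimum, the ruler value of the layer of `v` is a record when seen from `u`. There are
logarithmically many records in each direction and at most `k` vertices in each layer. -/
theorem Chain.solvable [Finite V] {U C S : Set V} {F : Set V → Prop} {k : ℕ} {l : V → ℕ}
    (h : Chain G U C F k S l) : Solvable G U C F 2 (fun r => 6 * k * Nat.log 2 r) := by
  classical
  refine ⟨S, h.sub, h.hit, h.hub, fun r hr => ?_⟩
  let L := Nat.log 2 r + 1
  have hrL : r < 2 ^ L := Nat.lt_pow_succ_log_self one_lt_two r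
  have hlog : 1 ≤ Nat.log 2 r := Nat.log_pos one_lt_two hr
  -- Layers with a large ruler value come first.
  refine ⟨fun v => L - ruler L (l v), fun u hu => ?_⟩
  let I₁ := {b ∈ Finset.Icc (l u) (l u + r) | ∀ i, l u ≤ i → i < b → ruler L i ≤ ruler L b}
  let I₂ := {b ∈ Finset.Icc (l u - r) (l u) | ∀ i, b ≤ i → i < l u → ruler L i ≤ ruler L b}
  have h₁ : I₁.card ≤ L + 1 := by
    refine card_records_le I₁ (fun b hb b' hb' => ?_) fun b hb b' hb' i hi hi' => ?_
    · simp only [I₁, Finset.mem_filter, Finset.mem_Icc] at hb hb'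
      omega
    · simp only [I₁, Finset.mem_filter, Finset.mem_Icc] at hb hb'
      exact Or.inr (hb'.2 i (by omega) hi')
  have h₂ : I₂.card ≤ L + 1 := by
    refine card_records_le I₂ (fun b hb b' hb' => ?_) fun b hb b' hb' i hi hi' => ?_
    · simp only [I₂, Finset.mem_filter, Finset.mem_Icc] at hb hb'
      omega
    · simp only [I₂, Finset.mem_filter, Finset.mem_Icc] at hb hb'
      exact Or.inl (hb.2 i (by omega) (by omega))
  refine (ncard_le_of_layers l (I₁ ∪ I₂) (n := k) (fun v hv => ?_) fun i => ?_).trans ?_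
  · obtain ⟨hvS, p, hpr, hp, hmin⟩ := hv
    have hd1 := le_add_length h.lip p hp
    have hp' : ∀ x ∈ p.reverse.support, x ∈ C := fun x hx => hp x (by simpa using hx)
    have hd2 := le_add_length h.lip p.reverse hp'
    rw [SimpleGraph.Walk.length_reverse] at hd2
    have hr : ∀ x ∈ p.support, x ∈ S → ruler L (l x) ≤ ruler L (l v) := by
      intro x hx hxS
      have : L - ruler L (l v) ≤ L - ruler L (l x) := hmin x hx hxS
      have := ruler_le L (l x)
      have := ruler_le L (l v)
      omega
    simp only [Finset.mem_union, I₁, I₂, Finset.mem_filter, Finset.mem_Icc]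
    rcases le_total (l u) (l v) with hle | hle
    · refine Or.inl ⟨by omega, fun i hi hi' => ?_⟩
      obtain ⟨x, hx, hxS, rfl⟩ := h.exists_mem_support p hp ⟨hi, hi'⟩
      exact hr x hx hxS
    · refine Or.inr ⟨by omega, fun i hi hi' => ?_⟩
      obtain ⟨x, hx, hxS, rfl⟩ := h.exists_mem_support p.reverse hp' ⟨hi, hi'⟩
      exact hr x (by simpa using hx) hxS
  · refine (Set.ncard_le_ncard ?_ (Set.toFinite _)).trans (h.card i)
    exact fun v hv => ⟨hv.1.1, hv.2⟩
  · have : (I₁ ∪ I₂).card ≤ 6 * Nat.log 2 r := by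
      refine (Finset.card_union_le _ _).trans ?_
      simp only [L] at h₁ h₂
      omega
    calc (I₁ ∪ I₂).card * k ≤ 6 * Nat.log 2 r * k := Nat.mul_le_mul_right _ this
      _ = 6 * k * Nat.log 2 r := by ring

/-- A connected hub touching `n` disjoint connected members of `F`. -/
abbrev Star (n : ℕ) (G : SimpleGraph V) (F : Set V → Prop) (U : Set V) : Prop :=
  Apex (⊥ : SimpleGraph (Fin n)) G F U

/-- Three disjoint and pairwise touching connected members of `F`. -/
abbrev Triangle (G : SimpleGraph V) (F : Set V → Prop) (U : Set V) : Prop :=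
  Contains (⊤ : SimpleGraph (Fin 3)) G F U

theorem star_of_leaves {ι : Type*} [Fintype ι] {n : ℕ} (hn : n ≤ Fintype.card ι) {U D : Set V}
    {F : Set V → Prop} (hD : Conn G D) (hDU : D ⊆ U) (T : ι → Set V) (hT : ∀ i, Conn G (T i))
    (hTU : ∀ i, T i ⊆ U) (hF : ∀ i, F (T i)) (ht : ∀ i, Touch G (T i) D)
    (hTD : ∀ i, Disjoint (T i) D) (hd : ∀ i j, i ≠ j → Disjoint (T i) (T j)) :
    Star n G F U := by
  obtain ⟨f⟩ : Nonempty (Fin n ↪ ι) :=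
    Function.Embedding.nonempty_of_card_le (by simpa using hn)
  refine ⟨D, hDU, hD, T ∘ f, fun i => hT _, fun i x hx => ⟨hTU _ hx, fun h =>
    (hTD (f i)).le_bot ⟨hx, h⟩⟩, fun i => ⟨hF _, ht _⟩, fun i j hij => hd _ _ (f.injective.ne hij),
    fun i j hij => ?_⟩
  simp at hij

/-- A star can be made to cover `E`; merging the leaf around `x` into the hub brings `x` into the
hub and costs at most one leaf. -/
theorem Star.exists_cover_insert [Finite V] {n : ℕ} (hn : 0 < n) {E : Set V} {F : Set V → Prop}
    (hF : UpClosed F) (hE : Pre G E) (h : Star n G F E) {x : V} (hx : x ∈ E) :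
    ∃ (i : Fin n) (D : Set V) (B : Fin n → Set V), Conn G D ∧ D ⊆ E ∧ x ∈ D ∧ (∀ i, Conn G (B i)) ∧
      (∀ i, B i ⊆ E) ∧ (∀ i, F (B i)) ∧ (∀ j, j ≠ i → Touch G (B j) D ∧ Disjoint (B j) D) ∧
      ∀ i j, i ≠ j → Disjoint (B i) (B j) := by
  obtain ⟨D, B, hD, hB, hBD, hBd, hcov⟩ := h.exists_cover hF hE
  obtain ⟨i, hi⟩ : ∃ i, x ∈ D ∪ B i := by
    rcases hcov.symm.subset hx with h | h
    · exact ⟨⟨0, hn⟩, Or.inl h⟩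
    · obtain ⟨i, hi⟩ := Set.mem_iUnion.1 h
      exact ⟨i, Or.inr hi⟩
  refine ⟨i, D ∪ B i, B, hD.union_of_touch (hB.conn i) (hBD i).symm, ?_, hi, hB.conn, hB.sub,
    hB.rich, fun j hj => ⟨(hBD j).mono subset_rfl Set.subset_union_left, ?_⟩, hB.disj⟩
  · exact Set.union_subset (Set.subset_union_left.trans hcov.subset) (hB.sub i)
  · exact Set.disjoint_union_right.2 ⟨hBd j, hB.disj j i hj⟩

/-- Two disjoint stars extend to the two sides of a connected partition of `U`. Their hubs can be
joined along a crossing edge at the loss of one leaf each, and `2 * (n - 1) ≥ n + 1` because `n ≥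
3`. -/
theorem Star.not_disjoint [Finite V] {n : ℕ} (hn : 3 ≤ n) {U A B : Set V} {F : Set V → Prop}
    (hF : UpClosed F) (hU : Conn G U) (hno : ¬ Star (n + 1) G F U) (hA : A ⊆ U) (hB : B ⊆ U)
    (hAc : Conn G A) (hBc : Conn G B) (hsA : Star n G F A) (hsB : Star n G F B) :
    ¬ Disjoint A B := by
  intro hd
  obtain ⟨E, E', hE, hE', hEd, hAE, hBE, hEU, x, hx, y, hy, hxy⟩ :=
    hU.2.exists_partition hA hB hAc hBc hd
  have hEs : E ⊆ U := Set.subset_union_left.trans hEU.subset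
  have hEs' : E' ⊆ U := Set.subset_union_right.trans hEU.subset
  obtain ⟨i, D, T, hD, hDE, hxD, hT, hTE, hTF, hTD, hTd⟩ :=
    Star.exists_cover_insert (by omega) hF hE.2 (hsA.mono hAE) hx
  obtain ⟨i', D', T', hD', hDE', hxD', hT', hTE', hTF', hTD', hTd'⟩ :=
    Star.exists_cover_insert (by omega) hF hE'.2 (hsB.mono hBE) hy
  refine hno (star_of_leaves (ι := {j // j ≠ i} ⊕ {j // j ≠ i'}) (D := D ∪ D') ?_
    (hD.union_of_touch hD' ⟨x, hxD, y, hxD', hxy⟩)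
    (Set.union_subset (hDE.trans hEs) (hDE'.trans hEs'))
    (Sum.elim (fun j => T j) (fun j => T' j)) ?_ ?_ ?_ ?_ ?_ ?_)
  · simp
    omega
  · rintro (j | j)
    exacts [hT _, hT' _]
  · rintro (j | j)
    exacts [(hTE _).trans hEs, (hTE' _).trans hEs']
  · rintro (j | j)
    exacts [hTF _, hTF' _]
  · rintro (j | j)
    exacts [(hTD j j.2).1.mono subset_rfl Set.subset_union_left,
      (hTD' j j.2).1.mono subset_rfl Set.subset_union_right]
  · rintro (j | j)
    · exact Set.disjoint_union_right.2 ⟨(hTD j j.2).2, hEd.mono (hTE _) hDE'⟩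
    · exact Set.disjoint_union_right.2 ⟨(hEd.mono hDE (hTE' _)).symm, (hTD' j j.2).2⟩
  · rintro (j | j) (l | l) hjl
    · exact hTd _ _ fun h => hjl (by rw [Subtype.ext h])
    · exact hEd.mono (hTE _) (hTE' _)
    · exact (hEd.mono (hTE _) (hTE' _)).symm
    · exact hTd' _ _ fun h => hjl (by rw [Subtype.ext h])

/-- With `U` partitioned into two connected sides and the first triangle covering its side, the
branch set at the crossing edge is a hub for the other two branch sets and for the whole second
side. -/
theorem Triangle.not_disjoint [Finite V] {U A B : Set V} {F : Set V → Prop}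
    (hF : UpClosed F) (hU : Conn G U) (hno : ¬ Star 3 G F U) (hA : A ⊆ U) (hB : B ⊆ U)
    (hAc : Conn G A) (hBc : Conn G B) (hsA : Triangle G F A) (hsB : Triangle G F B) :
    ¬ Disjoint A B := by
  intro hd
  obtain ⟨E, E', hE, hE', hEd, hAE, hBE, hEU, x, hx, y, hy, hxy⟩ :=
    hU.2.exists_partition hA hB hAc hBc hd
  have hEs : E ⊆ U := Set.subset_union_left.trans hEU.subset
  have hEs' : E' ⊆ U := Set.subset_union_right.trans hEU.subset
  obtain ⟨M, hM⟩ := hsA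
  obtain ⟨N, hN⟩ := hsB
  obtain ⟨T, hT, hMT, hTE, hTd⟩ := hE.2.exists_absorb M hM.conn
    (fun i => (hM.sub i).trans hAE) hM.disj
  obtain ⟨i, hi⟩ := Set.mem_iUnion.1 (hTE.symm.subset hx)
  have hTs : ∀ i, T i ⊆ E := fun i => (Set.subset_iUnion T i).trans hTE.subset
  refine hno (star_of_leaves (ι := {j // j ≠ i} ⊕ Unit) (D := T i) ?_ (hT i)
    ((hTs i).trans hEs) (Sum.elim (fun j => T j) (fun _ => E')) ?_ ?_ ?_ ?_ ?_ ?_)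
  · simp
  · rintro (j | j)
    exacts [hT _, hE']
  · rintro (j | j)
    exacts [(hTs _).trans hEs, hEs']
  · rintro (j | j)
    exacts [hF _ _ (hMT _) (hM.rich _), hF _ _ ((hN.sub 0).trans hBE) (hN.rich 0)]
  · rintro (j | j)
    · exact (hM.edge j i (by simpa using j.2)).mono (hMT _) (hMT _)
    · exact ⟨y, hy, x, hi, hxy.symm⟩
  · rintro (j | j)
    · exact hTd _ _ j.2
    · exact hEd.symm.mono_right (hTs i)
  · rintro (j | j) (l | l) hjl
    · exact hTd _ _ fun h => hjl (by rw [Subtype.ext h])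
    · exact hEd.mono_left (hTs _)
    · exact (hEd.mono_left (hTs _)).symm
    · exact (hjl rfl).elim

/-- In a connected set, if two nonadjacent components of a subset are removed, then some component
of what remains touches both. -/
theorem exists_isComp_touch_both {C R₁ R₂ : Set V} (hC : Pre G C) (h₁ : R₁ ⊆ C) (h₂ : R₂ ⊆ C)
    (hn₁ : R₁.Nonempty) (hn₂ : R₂.Nonempty) (hd : Disjoint R₁ R₂) (ht : ¬ Touch G R₁ R₂) :
    ∃ D, IsComp G (C \ (R₁ ∪ R₂)) D ∧ Touch G D R₁ ∧ Touch G D R₂ := by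
  by_contra! hcon
  let A : Set V := R₁ ∪ ⋃ D : {D // IsComp G (C \ (R₁ ∪ R₂)) D ∧ Touch G D R₁}, D.1
  obtain ⟨a, ha⟩ := hn₁
  obtain ⟨b, hb⟩ := hn₂
  have hbA : b ∉ A := by
    rintro (h | h)
    · exact hd.le_bot ⟨h, hb⟩
    · obtain ⟨D, hD⟩ := Set.mem_iUnion.1 h
      exact (D.2.1.sub hD).2 (Or.inr hb)
  obtain ⟨x, hx, y, hy, hxA, hyA, hadj⟩ := hC A ⟨a, h₁ ha, Or.inl ha⟩ ⟨b, h₂ hb, hbA⟩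
  have hy₁ : y ∉ R₁ := fun h => hyA (Or.inl h)
  rcases hxA with hxR | hxD
  · have hy₂ : y ∉ R₂ := fun h => ht ⟨x, hxR, y, h, hadj⟩
    obtain ⟨D, hD, hyD⟩ := exists_isComp_mem (G := G) (U := C \ (R₁ ∪ R₂)) ⟨hy, by simp [hy₁, hy₂]⟩
    exact hyA (Or.inr (Set.mem_iUnion.2 ⟨⟨D, hD, y, hyD, x, hxR, hadj.symm⟩, hyD⟩))
  · obtain ⟨D, hxD⟩ := Set.mem_iUnion.1 hxD
    by_cases hy₂ : y ∈ R₂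
    · exact hcon D.1 D.2.1 D.2.2 ⟨x, hxD, y, hy₂, hadj⟩
    · exact hyA (Or.inr (Set.mem_iUnion.2
        ⟨D, D.2.1.closed x hxD y ⟨hy, by simp [hy₁, hy₂]⟩ hadj⟩))

/-- Two disjoint rich subsets of `C` touching `Q = U \ C` would form a triangle with `Q`, so a
transversal `Z₁` hits them all. For a minimal transversal `Z ⊆ Z₁`, two rich components of `C \ Z`
would be leaves of a star whose third leaf is `Q`; hence there is at most one, and its complement in
`U` is connected. A poor component of `C \ Z` may have too many hubs, whereas `Z₁` guarantees a
preconnected complement in `C`. Therefore the final set keeps the part of `Z₁` outside the rich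
component. -/
theorem exists_chain_step [Finite V] {k : ℕ} (hk : Helly G k) {U C : Set V} {F : Set V → Prop}
    (hF : UpClosed F) (hU : Pre G U) (hstar : ¬ Star 3 G F U) (htri : ¬ Triangle G F U)
    (hCU : C ⊆ U) (hC : Conn G C) (hQ : Conn G (U \ C)) (hFQ : F (U \ C)) (hFC : F C) :
    ∃ Z ⊆ C, Z.Nonempty ∧ Z.ncard ≤ k ∧
      (∀ D, IsComp G (C \ Z) D →
        Hub G U D 2 ∧ (F D → ¬ Touch G D (U \ C) ∧ Conn G (U \ D))) ∧
      ∀ D E, IsComp G (C \ Z) D → IsComp G (C \ Z) E → F D → F E → D = E := by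
  set Q := U \ C with hQdef
  have hQC : Disjoint Q C := Set.disjoint_sdiff_left
  have hQU : Q ⊆ U := Set.sdiff_subset
  have hCQ : Touch G C Q := hU.touch_diff hCU hC.1 hQ.1
  let 𝓑 : Set (Set V) := {K | Conn G K ∧ K ⊆ C ∧ F K ∧ Touch G K Q}
  -- the members of `F` touching `Q` pairwise intersect, since there is no triangle
  have hint : ∀ A ∈ 𝓑, ∀ B ∈ 𝓑, (A ∩ B).Nonempty := by
    rintro A ⟨hA, hAC, hFA, hAQ⟩ B ⟨hB, hBC, hFB, hBQ⟩
    by_contra hno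
    obtain ⟨A', B', hA', hB', hd, hAA, hBB, hE, ht⟩ := hC.2.exists_partition hAC hBC hA hB
      (by rwa [← Set.not_disjoint_iff_nonempty_inter, not_not] at hno)
    have hAC' : A' ⊆ C := Set.subset_union_left.trans hE.subset
    have hBC' : B' ⊆ C := Set.subset_union_right.trans hE.subset
    have hAQ' := hAQ.mono hAA subset_rfl
    have hBQ' := hBQ.mono hBB subset_rfl
    have hAd := hQC.mono_right hAC'
    have hBd := hQC.mono_right hBC'
    refine htri ⟨![Q, A', B'], ?_, ?_, ?_, ?_, ?_⟩
    · intro i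
      fin_cases i
      exacts [hQ, hA', hB']
    · intro i
      fin_cases i
      exacts [hQU, hAC'.trans hCU, hBC'.trans hCU]
    · intro i
      fin_cases i
      exacts [hFQ, hF _ _ hAA hFA, hF _ _ hBB hFB]
    · intro i j hij
      fin_cases i <;> fin_cases j
      exacts [(hij rfl).elim, hAd, hBd, hAd.symm, (hij rfl).elim, hd, hBd.symm, hd.symm,
        (hij rfl).elim]
    · intro i j hij
      have hij := hij.ne
      fin_cases i <;> fin_cases j
      exacts [(hij rfl).elim, hAQ'.symm, hBQ'.symm, hAQ', (hij rfl).elim, ht, hBQ', ht.symm,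
        (hij rfl).elim]
  obtain ⟨Z₁, hZ₁C, hZ₁, hhit, hpre⟩ :=
    hk.exists_transversal hC 𝓑 (fun B hB => ⟨hB.1, hB.2.1⟩) hint
  obtain ⟨Z, hZZ₁, hZ⟩ := exists_minimal_transversal 𝓑 C Z₁ k hZ₁ (fun B hB => hB.2.1) hhit
  let R : Set V → Prop := fun D => IsComp G (C \ Z) D ∧ F D
  have hRC : ∀ D, R D → D ⊆ C := fun D hD => hD.1.sub.trans Set.sdiff_subset
  have hRQ : ∀ D, R D → ¬ Touch G D Q := by
    intro D hD ht
    obtain ⟨x, hx, hxZ⟩ := hZ.prop.2 D ⟨hD.1.conn, hRC D hD, hD.2, ht⟩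
    exact (hD.1.sub hx).2 hxZ
  -- components of `C` minus one or two rich components touch `Q`
  have htouch : ∀ R₁ R₂, R R₁ → R R₂ → ∀ D, IsComp G (C \ (R₁ ∪ R₂)) D → Touch G D Q := by
    intro R₁ R₂ h₁ h₂ D hD
    by_contra hDQ
    have hR12 : R₁ ∪ R₂ ⊆ C := Set.union_subset (hRC _ h₁) (hRC _ h₂)
    have hZD : (Z ∩ D).Nonempty := by
      obtain ⟨x, hx, y, hy, hadj⟩ := hD.touch_of_pre hC.2 hR12
        (h₁.1.conn.1.mono Set.subset_union_left)
      refine ⟨x, ?_, hx⟩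
      by_contra hxZ
      rcases hy with hy | hy
      · exact (hD.sub hx).2 (Or.inl (h₁.1.closed y hy x ⟨(hD.sub hx).1, hxZ⟩ hadj.symm))
      · exact (hD.sub hx).2 (Or.inr (h₂.1.closed y hy x ⟨(hD.sub hx).1, hxZ⟩ hadj.symm))
    -- Minimality gives a member of `𝓑` that meets `Z` only in `D`. It cannot leave `D ∪ R₁ ∪ R₂`,
    -- yet none of these three sets touches `Q`.
    obtain ⟨K, hK, hKZ⟩ : ∃ K ∈ 𝓑, K ∩ Z ⊆ D := by
      by_contra! hcon
      obtain ⟨z, hz, hzD⟩ := hZD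
      refine (hZ.le_of_le (y := Z \ D) ⟨size_prop_mono Z _ Set.sdiff_subset hZ.prop.1,
        fun B hB => ?_⟩ Set.sdiff_subset hz).2 hzD
      obtain ⟨x, hx, hxD⟩ := Set.not_subset.1 (hcon B hB)
      exact ⟨x, hx.1, hx.2, hxD⟩
    obtain ⟨z, hzK, hzZ⟩ := hZ.prop.2 K hK
    have hsub : K ⊆ D ∪ (R₁ ∪ R₂) := by
      refine hK.1.2.subset_of_closed ⟨z, hzK, Or.inl (hKZ ⟨hzK, hzZ⟩)⟩ ?_
      rintro x hx hxm y hy hadj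
      by_cases hyR : y ∈ R₁ ∪ R₂
      · exact Or.inr hyR
      left
      by_cases hyZ : y ∈ Z
      · exact hKZ ⟨hy, hyZ⟩
      rcases hxm with hxD | hxR | hxR
      · exact hD.closed x hxD y ⟨hK.2.1 hy, hyR⟩ hadj
      · exact (hyR (Or.inl (h₁.1.closed x hxR y ⟨hK.2.1 hy, hyZ⟩ hadj))).elim
      · exact (hyR (Or.inr (h₂.1.closed x hxR y ⟨hK.2.1 hy, hyZ⟩ hadj))).elim
    obtain ⟨x, hx, q, hq, hadj⟩ := hK.2.2.2
    rcases hsub hx with h | h | h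
    · exact hDQ ⟨x, h, q, hq, hadj⟩
    · exact hRQ _ h₁ ⟨x, h, q, hq, hadj⟩
    · exact hRQ _ h₂ ⟨x, h, q, hq, hadj⟩
  have hone : ∀ D E, R D → R E → D = E := by
    intro R₁ R₂ h₁ h₂
    by_contra hne
    have hd := h₁.1.disjoint h₂.1 hne
    obtain ⟨D, hD, ht₁, ht₂⟩ := exists_isComp_touch_both hC.2 (hRC _ h₁) (hRC _ h₂) h₁.1.conn.1
      h₂.1.conn.1 hd (h₁.1.not_touch h₂.1 hne)
    have htQ := htouch R₁ R₂ h₁ h₂ D hD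
    have hDC : D ⊆ C := hD.sub.trans Set.sdiff_subset
    have hDR : Disjoint D (R₁ ∪ R₂) := Set.disjoint_left.2 fun x hx => (hD.sub hx).2
    have hQ₁ := hQC.mono_right (hRC _ h₁)
    have hQ₂ := hQC.mono_right (hRC _ h₂)
    refine hstar ⟨D, hDC.trans hCU, hD.conn, ![Q, R₁, R₂], ?_, ?_, ?_, ?_, ?_⟩
    · intro i
      fin_cases i
      exacts [hQ, h₁.1.conn, h₂.1.conn]
    · intro i
      fin_cases i
      · exact fun x hx => ⟨hQU hx, fun h => hQC.le_bot ⟨hx, hDC h⟩⟩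
      · exact fun x hx => ⟨hCU (hRC _ h₁ hx), fun h => hDR.le_bot ⟨h, Or.inl hx⟩⟩
      · exact fun x hx => ⟨hCU (hRC _ h₂ hx), fun h => hDR.le_bot ⟨h, Or.inr hx⟩⟩
    · intro i
      fin_cases i
      exacts [⟨hFQ, htQ.symm⟩, ⟨h₁.2, ht₁.symm⟩, ⟨h₂.2, ht₂.symm⟩]
    · intro i j hij
      fin_cases i <;> fin_cases j
      exacts [(hij rfl).elim, hQ₁, hQ₂, hQ₁.symm, (hij rfl).elim, hd, hQ₂.symm, hd.symm,
        (hij rfl).elim]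
    · intro i j hij
      simp at hij
  have hRpre : ∀ D, R D → Conn G (U \ D) := by
    intro D hD
    have h := hQ.biUnion_hub (fun E : {E // IsComp G (C \ (D ∪ D)) E} => E.1)
      (fun E => E.2.conn.2) fun E => htouch D D hD hD E.1 E.2
    convert h using 1
    ext x
    constructor
    · rintro ⟨hxU, hxD⟩
      by_cases hxC : x ∈ C
      · obtain ⟨E, hE, hxE⟩ := exists_isComp_mem (G := G) (U := C \ (D ∪ D)) ⟨hxC, by simpa⟩
        exact Or.inr (Set.mem_iUnion.2 ⟨⟨E, hE⟩, hxE⟩)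
      · exact Or.inl ⟨hxU, hxC⟩
    · rintro (hx | hx)
      · exact ⟨hx.1, fun h => hx.2 (hRC D hD h)⟩
      · obtain ⟨E, hE⟩ := Set.mem_iUnion.1 hx
        exact ⟨hCU (E.2.sub hE).1, fun h => (E.2.sub hE).2 (Or.inl h)⟩
  -- keep the vertices of `Z₁` outside the rich component
  let Z' : Set V := {x ∈ Z₁ | ∀ D, R D → x ∉ D}
  have hZZ' : Z ⊆ Z' := fun x hx => ⟨hZZ₁ hx, fun D hD h => (hD.1.sub h).2 hx⟩
  have hZ'C : Z' ⊆ C := fun x hx => hZ₁C hx.1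
  have hcomp : ∀ D, IsComp G (C \ Z') D → R D ∨ (IsComp G (C \ Z₁) D ∧ ¬ F D) := by
    intro D hD
    obtain ⟨E, hE, hDE⟩ := hD.conn.2.exists_isComp (U := C \ Z)
      (fun x hx => ⟨(hD.sub hx).1, fun h => (hD.sub hx).2 (hZZ' h)⟩) hD.conn.1
    have hmeet : ∀ A, R A → (A ∩ D).Nonempty → R D := by
      intro A hA hAD
      have hAE : A = E := hA.1.eq_of_inter hE (hAD.mono fun x hx => ⟨hx.1, hDE hx.2⟩)
      have : A ⊆ D := hD.subset_of_inter hA.1.conn.2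
        (fun x hx => ⟨hRC A hA hx, fun h => h.2 A hA hx⟩) hAD
      rwa [hDE.antisymm (hAE ▸ this), ← hAE]
    by_cases hRD : R D
    · exact Or.inl hRD
    · refine Or.inr ⟨⟨fun x hx => ⟨(hD.sub hx).1, fun hxZ => (hD.sub hx).2 ⟨hxZ, fun A hA hxA =>
        hRD (hmeet A hA ⟨x, hxA, hx⟩)⟩⟩, hD.conn, fun x hx y hy hadj => hD.closed x hx y
          ⟨hy.1, fun h => hy.2 h.1⟩ hadj⟩, fun hFD => hRD ?_⟩
      exact hmeet E ⟨hE, hF _ _ hDE hFD⟩ (by rw [Set.inter_eq_right.2 hDE]; exact hD.conn.1)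
  refine ⟨Z', hZ'C, ?_, (Set.ncard_le_ncard (fun x hx => hx.1) (Set.toFinite _)).trans hZ₁,
    fun D hD => ?_, fun D E hD hE hFD hFE => ?_⟩
  · obtain ⟨x, -, hx⟩ := hZ.prop.2 C ⟨hC, subset_rfl, hFC, hCQ⟩
    exact ⟨x, hZZ' hx⟩
  · rcases hcomp D hD with h | ⟨h, hn⟩
    · exact ⟨Hub.of_pre (hRpre D h).2, fun _ => ⟨hRQ D h, hRpre D h⟩⟩
    · refine ⟨Hub.of_pair hQ.2 (hpre D h) ?_, fun hFD => (hn hFD).elim⟩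
      ext x
      have hDC : x ∈ D → x ∈ C := fun hx => (h.sub hx).1
      have hCU' : x ∈ C → x ∈ U := fun hx => hCU hx
      simp only [hQdef, Set.mem_union, Set.mem_sdiff]
      tauto
  · exact hone D E ((hcomp D hD).resolve_right fun h => h.2 hFD)
      ((hcomp E hE).resolve_right fun h => h.2 hFE)

/-- The set from `exists_chain_step` is the layer `0`, and the recursion enters the only rich
component `D`. Vertices of `C` outside `D` with a neighbor in `D` lie in that set, so the layers
separate; uniqueness of `D` keeps each layer of size at most `k`. -/
theorem exists_chain [Finite V] {k : ℕ} (hk : Helly G k) {U C : Set V} {F : Set V → Prop}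
    (hF : UpClosed F) (hU : Pre G U) (hstar : ¬ Star 3 G F U) (htri : ¬ Triangle G F U)
    (hCU : C ⊆ U) (hC : Conn G C) (hQ : Conn G (U \ C)) (hFQ : F (U \ C)) :
    ∃ S l, Chain G U C F k S l := by
  classical
  induction hm : C.ncard using Nat.strong_induction_on generalizing C with
  | _ m ih =>
  by_cases hFC : F C
  swap
  · refine ⟨∅, fun _ => 0, Set.empty_subset _, fun K hK _ h => hFC (hF _ _ (hK.trans
      Set.sdiff_subset) h), fun D hD => ?_, by simp, by simp, by simp, by simp⟩
    rw [Set.sdiff_empty] at hD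
    rw [hD.eq_self hC]
    exact Hub.of_pre hQ.2
  obtain ⟨Z, hZC, hZn, hZ, hZD, hone⟩ := exists_chain_step hk hF hU hstar htri hCU hC hQ hFQ hFC
  have hin : ∀ T : Set V, ∀ K ⊆ C \ (Z ∪ T), Conn G K → ∃ D, IsComp G (C \ Z) D ∧ K ⊆ D := by
    intro T K hK hc
    exact hc.2.exists_isComp (fun x hx => ⟨(hK hx).1, fun h => (hK hx).2 (Or.inl h)⟩) hc.1
  by_cases hex : ∃ D, IsComp G (C \ Z) D ∧ F D
  swap
  · refine ⟨Z, fun _ => 0, hZC, fun K hK hc hFK => ?_, fun D hD => (hZD D hD).1, by simp, by simp,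
      by simp, fun i => (Set.ncard_le_ncard (fun x hx => hx.1) (Set.toFinite _)).trans hZ⟩
    obtain ⟨D, hD, hKD⟩ := hin ∅ K (by simpa using hK) hc
    exact hex ⟨D, hD, hF _ _ hKD hFK⟩
  obtain ⟨D, hD, hFD⟩ := hex
  have hDC : D ⊆ C := hD.sub.trans Set.sdiff_subset
  obtain ⟨hDQ, hDc⟩ := (hZD D hD).2 hFD
  have hlt : D.ncard < m := by
    rw [← hm]
    refine Set.ncard_lt_ncard ⟨hDC, fun h => ?_⟩ (Set.toFinite _)
    obtain ⟨z, hz⟩ := hZn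
    exact (hD.sub (h (hZC hz))).2 hz
  obtain ⟨S, l, h⟩ := ih _ hlt (hDC.trans hCU) hD.conn hDc
    (hF _ _ (Set.sdiff_subset_sdiff_right hDC) hFQ) rfl
  let l' : V → ℕ := fun x => if x ∈ D then l x + 1 else 0
  have hl1 : ∀ x ∈ D, l' x = l x + 1 := fun x hx => if_pos hx
  have hl0 : ∀ x, x ∉ D → l' x = 0 := fun x hx => if_neg hx
  have hZ_of : ∀ x ∈ C, x ∉ D → ∀ y ∈ D, G.Adj x y → x ∈ Z := by
    intro x hx hxD y hy hadj
    by_contra hxZ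
    exact hxD (hD.closed y hy x ⟨hx, hxZ⟩ hadj.symm)
  refine ⟨Z ∪ S, l', Set.union_subset hZC (h.sub.trans hDC), ?_, ?_, ?_, ?_, ?_, ?_⟩
  · intro K hK hc hFK
    obtain ⟨E, hE, hKE⟩ := hin S K hK hc
    obtain rfl := hone D E hD hE hFD (hF _ _ hKE hFK)
    exact h.hit K (fun x hx => ⟨hKE hx, fun hS => (hK hx).2 (Or.inr hS)⟩) hc hFK
  · intro E hE
    obtain ⟨E₀, hE₀, hEE⟩ := hin S E hE.sub hE.conn
    by_cases hED : E₀ = D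
    · subst hED
      refine h.hub E ⟨fun x hx => ⟨hEE hx, fun hS => (hE.sub hx).2 (Or.inr hS)⟩, hE.conn,
        fun x hx y hy hadj => hE.closed x hx y ⟨hDC hy.1, ?_⟩ hadj⟩
      rintro (hyZ | hyS)
      exacts [(hD.sub hy.1).2 hyZ, hy.2 hyS]
    · have hd := hE₀.disjoint hD hED
      have : E₀ ⊆ E := by
        refine hE.subset_of_inter hE₀.conn.2 (fun x hx => ⟨(hE₀.sub hx).1, ?_⟩) ?_
        · rintro (hxZ | hxS)
          exacts [(hE₀.sub hx).2 hxZ, hd.le_bot ⟨hx, h.sub hxS⟩]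
        · rw [Set.inter_eq_right.2 hEE]; exact hE.conn.1
      rw [hEE.antisymm this]
      exact (hZD E₀ hE₀).1
  · intro x hx y hy hadj
    by_cases hxD : x ∈ D
    · rw [hl1 x hxD]
      by_cases hyD : y ∈ D
      · rw [hl1 y hyD]
        exact Nat.succ_le_succ (h.lip x hxD y hyD hadj)
      · rw [h.boundary x hxD y (hCU hy) hyD hadj]
        omega
    · rw [hl0 x hxD]
      exact Nat.zero_le _
  · intro x hx y hy hadj hxy
    by_cases hyD : y ∈ D
    · by_cases hxD : x ∈ D
      · rw [hl1 x hxD, hl1 y hyD] at hxy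
        exact Or.inr (h.sep x hxD y hyD hadj (Nat.succ_injective hxy))
      · exact Or.inl (hZ_of x hx hxD y hyD hadj)
    · rw [hl0 y hyD] at hxy
      omega
  · intro x hx y hy hyC hadj
    exact hl0 x fun hxD => hDQ ⟨x, hxD, y, ⟨hy, hyC⟩, hadj⟩
  · rintro (_ | i)
    · refine (Set.ncard_le_ncard ?_ (Set.toFinite _)).trans hZ
      rintro x ⟨hx | hx, hl⟩
      · exact hx
      · rw [hl1 x (h.sub hx)] at hl
        omega
    · refine (Set.ncard_le_ncard ?_ (Set.toFinite _)).trans (h.card i)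
      rintro x ⟨hx, hl⟩
      by_cases hxD : x ∈ D
      · rw [hl1 x hxD] at hl
        refine ⟨hx.resolve_left fun hxZ => (hD.sub hxD).2 hxZ, Nat.succ_injective hl⟩
      · rw [hl0 x hxD] at hl
        omega

/-- The rich connected sets whose complement contains no rich connected set pairwise intersect.
After hitting them, every rich component `C` has a rich and connected complement in `U`, from which
a chain can start. -/
theorem solvable_of_not_star_of_not_triangle [Finite V] {k : ℕ} (hk : Helly G k) {U : Set V}
    {F : Set V → Prop} (hF : UpClosed F) (hU : Conn G U) (hstar : ¬ Star 3 G F U)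
    (htri : ¬ Triangle G F U) : Solvable G U U F 2 (fun r => k + 6 * k * Nat.log 2 r) := by
  obtain ⟨Z, hZU, hZ, hhit, hpre⟩ := hk.exists_transversal hU
    {B | Conn G B ∧ B ⊆ U ∧ F B ∧ ∀ K ⊆ U \ B, Conn G K → ¬ F K} (fun B hB => ⟨hB.1, hB.2.1⟩) (by
      rintro A ⟨-, -, -, hA⟩ B ⟨hB, hBU, hFB, -⟩
      by_contra hno
      refine hA B (fun x hx => ⟨hBU hx, fun hxA => hno ⟨x, hxA, hx⟩⟩) hB hFB)
  refine Solvable.compose hZU (fun r _ => WC.of_ncard_le hZ) fun C hC => ?_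
  have hCU : C ⊆ U := hC.sub.trans Set.sdiff_subset
  by_cases hFC : F C
  · obtain ⟨K, hK, hKc, hFK⟩ : ∃ K ⊆ U \ C, Conn G K ∧ F K := by
      by_contra! hcon
      obtain ⟨x, hx, hxZ⟩ := hhit C ⟨hC.conn, hCU, hFC, hcon⟩
      exact (hC.sub hx).2 hxZ
    obtain ⟨S, l, h⟩ := exists_chain hk hF hU.2 hstar htri hCU hC.conn
      ⟨hKc.1.mono hK, hpre C hC⟩ (hF _ _ hK hFK)
    exact h.solvable
  · refine ⟨∅, Set.empty_subset _, fun K hK _ hFK => hFC (hF _ _ (hK.trans Set.sdiff_subset) hFK),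
      fun D hD => ?_, fun r _ => WC.of_ncard_le (by simp)⟩
    rw [Set.sdiff_empty] at hD
    rw [hD.eq_self hC.conn]
    exact Hub.of_pre (hpre C hC)

/-- Excluding stars with one leaf more makes the sets containing the smaller star pairwise
intersecting, so each increment of `n` costs one transversal. For three leaves, the triangles are
removed in this way. -/
theorem solvable_of_not_star (n : ℕ) : ∃ c : ℕ, ∀ (V : Type v) [Finite V] (G : SimpleGraph V)
    (k : ℕ), Helly G k → ∀ U, Conn G U → ∀ F, UpClosed F → ¬ Star (n + 3) G F U →
      Solvable G U U F 2 (fun r => c * k * Nat.log 2 r) := by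
  have hk : ∀ k r, 2 ≤ r → k ≤ k * Nat.log 2 r := fun k r hr =>
    Nat.le_mul_of_pos_right k (Nat.log_pos one_lt_two hr)
  induction n with
  | zero =>
    refine ⟨72, fun V _ G k hG U hU F hF hno => ?_⟩
    refine (Solvable.of_intersecting hG hU (Triangle G F)
      (fun A hA B hB hAc hBc => Triangle.not_disjoint hF hU hno hA hB hAc hBc)
      fun C hCU hC hn => solvable_of_not_star_of_not_triangle hG hF hC
        (fun h => hno (h.mono hCU)) hn).mono fun r hr => ?_
    nlinarith [hk k r hr]
  | succ n ih =>
    obtain ⟨c, hc⟩ := ih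
    refine ⟨c + 65, fun V _ G k hG U hU F hF hno => ?_⟩
    refine (Solvable.of_intersecting hG hU (Star (n + 3) G F)
      (fun A hA B hB hAc hBc => Star.not_disjoint (by omega) hF hU hno hA hB hAc hBc)
      fun C hCU hC hn => hc V G k hG C hC F hF hn).mono fun r hr => ?_
    nlinarith [hk k r hr]

theorem apexHit_bot {W : Type u} [Finite W] {X : SimpleGraph W} (hX : ∀ x y, ¬ X.Adj x y) :
    ApexHit.{u, v} (fun r => Nat.log 2 r) X := by
  obtain ⟨n, ⟨e⟩⟩ := Finite.exists_equiv_fin W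
  obtain ⟨c, hc⟩ := solvable_of_not_star.{v} n
  refine ⟨c, fun V _ G k hG U hU F hF hno => hc V G k hG U hU F hF fun h => hno ?_⟩
  exact h.comp (fun x => (e x).castAdd 3) (fun x y h => e.injective (Fin.castAdd_injective n 3 h))
    fun x y h => (hX x y h).elim

end Chains

/-! ### Induction along rooted `2`-treedepth -/

section RootedTreedepth

variable {W : Type u} {X : SimpleGraph W}

theorem rtd₂Sub_exists_separation [Finite W] {H : X.Subgraph} (h : 2 ≤ H.verts.ncard) :
    ∃ (A B : X.Subgraph) (k : ℕ), IsSeparation H A B k ∧ k ≤ 1 ∧ A.verts.Nonempty ∧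
      (B.verts \ A.verts).Nonempty ∧
      rtd₂Sub H = max (rtd₂Sub A) (rtd₂Sub (B.deleteVerts A.verts) + (A.verts ∩ B.verts).ncard) := by
  have hne : {n : ℕ | ∃ (A B : X.Subgraph) (k : ℕ)
      (_ : IsSeparation H A B k ∧ k ≤ 1 ∧ A.verts.Nonempty ∧ (B.verts \ A.verts).Nonempty),
      n = max (rtd₂Sub A)
        (rtd₂Sub (B.deleteVerts A.verts) + (A.verts ∩ B.verts).ncard)}.Nonempty := by
    obtain ⟨a, ha, b, hb, hab⟩ := (Set.one_lt_ncard (Set.toFinite _)).1 h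
    refine ⟨_, X.singletonSubgraph a, H, 1, ⟨⟨?_, ?_, ?_⟩, le_rfl, ⟨a, rfl⟩, b, hb, hab.symm⟩, rfl⟩
    · exact sup_eq_right.2 ((X.singletonSubgraph_le_iff a H).2 ha)
    · ext e
      induction e with | _ x y => simp
    · have : (X.singletonSubgraph a ⊓ H).verts = {a} := by
        ext x
        simp only [SimpleGraph.Subgraph.verts_inf, SimpleGraph.singletonSubgraph_verts,
          Set.mem_inter_iff, Set.mem_singleton_iff, and_iff_left_iff_imp]
        rintro rfl
        exact ha
      rw [this, Set.ncard_singleton]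
  obtain ⟨A, B, k, ⟨h1, h2, h3, h4⟩, h5⟩ := Nat.sInf_mem hne
  refine ⟨A, B, k, h1, h2, h3, h4, ?_⟩
  rw [← h5, rtd₂Sub, if_neg (by omega), if_neg (by omega)]

theorem IsSeparation.verts_eq {H A B : X.Subgraph} {k : ℕ} (h : IsSeparation H A B k) :
    H.verts = A.verts ∪ B.verts := by
  rw [← h.union_eq]; rfl

theorem IsSeparation.adj {H A B : X.Subgraph} {k : ℕ} (h : IsSeparation H A B k) {x y : W}
    (hxy : H.Adj x y) : A.Adj x y ∨ B.Adj x y := by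
  rw [← h.union_eq] at hxy
  exact hxy

theorem IsSeparation.ncard_left_lt [Finite W] {H A B : X.Subgraph} {k : ℕ} (h : IsSeparation H A B k)
    (hne : (B.verts \ A.verts).Nonempty) : A.verts.ncard < H.verts.ncard := by
  obtain ⟨b, hb, hbA⟩ := hne
  refine Set.ncard_lt_ncard ?_ (Set.toFinite _)
  rw [h.verts_eq]
  exact ⟨Set.subset_union_left, fun hs => hbA (hs (Or.inr hb))⟩

theorem IsSeparation.ncard_right_lt [Finite W] {H A B : X.Subgraph} {k : ℕ} (h : IsSeparation H A B k)
    (hne : A.verts.Nonempty) : (B.deleteVerts A.verts).verts.ncard < H.verts.ncard := by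
  obtain ⟨a, ha⟩ := hne
  refine Set.ncard_lt_ncard ?_ (Set.toFinite _)
  rw [h.verts_eq]
  exact ⟨fun x hx => Or.inr hx.1, fun hs => (hs (Or.inl ha)).2 ha⟩

theorem rtd₂Sub_pos [Finite W] {H : X.Subgraph} (h : H.verts.Nonempty) : 1 ≤ rtd₂Sub H := by
  induction hn : H.verts.ncard using Nat.strong_induction_on generalizing H with
  | _ n ih =>
  have hpos : 0 < H.verts.ncard := (Set.ncard_pos (Set.toFinite _)).2 h
  by_cases h1 : H.verts.ncard = 1
  · rw [rtd₂Sub, if_neg (by omega), if_pos h1]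
  · obtain ⟨A, B, k, hs, -, hA, hB, he⟩ := rtd₂Sub_exists_separation (H := H) (by omega)
    rw [he]
    exact (ih _ (hn ▸ hs.ncard_left_lt hB) hA rfl).trans (le_max_left _ _)

/-- In an optimal separation, `B - V(A)` is nonempty and already has value at least `1`, which
leaves no room for a common vertex. So every edge lies in one of the two smaller parts. -/
theorem not_adj_of_rtd₂Sub_le_one [Finite W] {H : X.Subgraph} (h : rtd₂Sub H ≤ 1) (x y : W) :
    ¬ H.Adj x y := by
  induction hn : H.verts.ncard using Nat.strong_induction_on generalizing H with
  | _ n ih =>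
  intro hxy
  have h2 : 2 ≤ H.verts.ncard :=
    (Set.one_lt_ncard (Set.toFinite _)).2 ⟨x, hxy.fst_mem, y, hxy.snd_mem, hxy.adj_sub.ne⟩
  obtain ⟨A, B, k, hs, -, hA, hB, he⟩ := rtd₂Sub_exists_separation h2
  rw [he] at h
  have h1 := (le_max_left _ _).trans h
  have h3 := (le_max_right _ _).trans h
  have h4 : 1 ≤ rtd₂Sub (B.deleteVerts A.verts) := rtd₂Sub_pos hB
  have h5 : (A.verts ∩ B.verts).ncard = 0 := by omega
  rw [Set.ncard_eq_zero (Set.toFinite _)] at h5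
  have hdis : ∀ z ∈ B.verts, z ∉ A.verts := fun z hz hzA =>
    (Set.eq_empty_iff_forall_notMem.1 h5) z ⟨hzA, hz⟩
  rcases hs.adj hxy with hadj | hadj
  · exact ih _ (hn ▸ hs.ncard_left_lt hB) h1 rfl hadj
  · refine ih _ (hn ▸ hs.ncard_right_lt hA) (H := B.deleteVerts A.verts) (by omega) rfl ?_
    rw [SimpleGraph.Subgraph.deleteVerts_adj]
    exact ⟨hadj.fst_mem, hdis _ hadj.fst_mem, hadj.snd_mem, hdis _ hadj.snd_mem, hadj⟩

/-- An optimal separation either has disjoint sides, handled by `Hit.sum`, or a single common vertex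
`a`. In the latter case `Y = B - V(A)` has smaller value, and `H` embeds into `A` with `Y` attached
completely to `a`. -/
theorem hit_of_apexHit [Finite W] (s : ℕ) (hg : ∀ r, 2 ≤ r → 1 ≤ r ^ s * Nat.log 2 r)
    (hapex : ∀ Y : X.Subgraph, rtd₂Sub Y + 1 ≤ s + 2 → Y.verts.Nonempty → ∀ m,
      ApexHit.{u, v} (fun r => r ^ s * Nat.log 2 r) (copies m Y.coe))
    (H : X.Subgraph) (h : rtd₂Sub H ≤ s + 2) :
    Hit.{u, v} (fun r => r ^ s * Nat.log 2 r) H.coe := by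
  classical
  induction hn : H.verts.ncard using Nat.strong_induction_on generalizing H with
  | _ n ih =>
  by_cases h2 : 2 ≤ H.verts.ncard
  swap
  · have : Subsingleton H.verts := by
      rw [Set.subsingleton_coe]
      exact Set.ncard_le_one_iff_subsingleton.1 (by omega)
    exact Hit.of_subsingleton
  obtain ⟨A, B, k, hs, hk, hA, hB, he⟩ := rtd₂Sub_exists_separation h2
  rw [he] at h
  have hA1 := (le_max_left _ _).trans h
  have hB1 := (le_max_right _ _).trans h
  have hcard : (A.verts ∩ B.verts).ncard ≤ 1 := by
    rw [← hs.order_eq] at hk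
    exact hk
  set Y := B.deleteVerts A.verts with hY
  have hHA := ih _ (hn ▸ hs.ncard_left_lt hB) A hA1 rfl
  have hYmem : ∀ x ∈ H.verts, x ∉ A.verts → x ∈ Y.verts := by
    intro x hx hxA
    rw [hs.verts_eq] at hx
    exact ⟨hx.resolve_left hxA, hxA⟩
  let f : H.verts → A.verts ⊕ Y.verts := fun x =>
    if hx : x.1 ∈ A.verts then Sum.inl ⟨x.1, hx⟩ else Sum.inr ⟨x.1, hYmem x.1 x.2 hx⟩
  have hfl : ∀ (x : H.verts) (hx : x.1 ∈ A.verts), f x = Sum.inl ⟨x.1, hx⟩ :=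
    fun x hx => dif_pos hx
  have hfr : ∀ (x : H.verts) (hx : x.1 ∉ A.verts), f x = Sum.inr ⟨x.1, hYmem x.1 x.2 hx⟩ :=
    fun x hx => dif_neg hx
  have hf : Function.Injective f := by
    intro x y hxy
    by_cases hx : x.1 ∈ A.verts <;> by_cases hy : y.1 ∈ A.verts
    · rw [hfl x hx, hfl y hy] at hxy
      have := Sum.inl.inj hxy
      exact Subtype.ext (Subtype.mk.inj this)
    · rw [hfl x hx, hfr y hy] at hxy
      exact (Sum.inl_ne_inr hxy).elim
    · rw [hfr x hx, hfl y hy] at hxy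
      exact (Sum.inr_ne_inl hxy).elim
    · rw [hfr x hx, hfr y hy] at hxy
      have := Sum.inr.inj hxy
      exact Subtype.ext (Subtype.mk.inj this)
  have hYadj : ∀ x y, B.Adj x y → x ∉ A.verts → y ∉ A.verts → Y.Adj x y := by
    intro x y hxy hx hy
    rw [hY, SimpleGraph.Subgraph.deleteVerts_adj]
    exact ⟨hxy.fst_mem, hx, hxy.snd_mem, hy, hxy⟩
  rcases (A.verts ∩ B.verts).eq_empty_or_nonempty with hemp | ⟨a, haA, haB⟩
  · have hdis : ∀ z ∈ B.verts, z ∉ A.verts := fun z hz hzA =>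
      (Set.eq_empty_iff_forall_notMem.1 hemp) z ⟨hzA, hz⟩
    have hHY := ih _ (hn ▸ hs.ncard_right_lt hA) Y ((Nat.le_add_right _ _).trans hB1) rfl
    refine (hHA.sum hg hHY).comp f hf fun x y hxy => ?_
    rcases hs.adj hxy with hadj | hadj
    · rw [hfl x hadj.fst_mem, hfl y hadj.snd_mem, SimpleGraph.sum_adj_inl]
      exact hadj
    · have hx := hdis _ hadj.fst_mem
      have hy := hdis _ hadj.snd_mem
      rw [hfr x hx, hfr y hy, SimpleGraph.sum_adj_inr]
      exact hYadj _ _ hadj hx hy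
  · have huniq : ∀ z ∈ B.verts, z ∈ A.verts → z = a := fun z hz hzA =>
      (Set.ncard_le_one_iff (Set.toFinite _)).1 hcard ⟨hzA, hz⟩ ⟨haA, haB⟩
    have h1 : (A.verts ∩ B.verts).ncard = 1 := le_antisymm hcard
      ((Set.ncard_pos (Set.toFinite _)).2 ⟨a, haA, haB⟩)
    have : Nonempty Y.verts := Set.Nonempty.to_subtype hB
    have : Fintype A.verts := Fintype.ofFinite _
    refine Hit.attach hg hHA (hapex Y (by omega) hB _) ⟨a, haA⟩ f hf fun x y hxy => ?_
    rcases hs.adj hxy with hadj | hadj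
    · rw [hfl x hadj.fst_mem, hfl y hadj.snd_mem]
      exact hadj
    · by_cases hx : x.1 ∈ A.verts <;> by_cases hy : y.1 ∈ A.verts
      · exact (hadj.adj_sub.ne ((huniq _ hadj.fst_mem hx).trans
          (huniq _ hadj.snd_mem hy).symm)).elim
      · rw [hfl x hx, hfr y hy]
        exact Subtype.ext (huniq _ hadj.fst_mem hx)
      · rw [hfr x hx, hfl y hy]
        exact Subtype.ext (huniq _ hadj.snd_mem hy)
      · rw [hfr x hx, hfr y hy]
        exact hYadj _ _ hadj hx hy

/-- For `s = 0` the attached graphs are edgeless and `apexHit_bot` gives the logarithm. For larger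
`s` they satisfy `Hit` with exponent one less, by induction, and `Hit.apexHit` supplies the missing
factor `r`. -/
theorem hit_of_rtd₂Sub_le [Finite W] (s : ℕ) (H : X.Subgraph) (h : rtd₂Sub H ≤ s + 2) :
    Hit.{u, v} (fun r => r ^ s * Nat.log 2 r) H.coe := by
  classical
  have hg : ∀ s r, 2 ≤ r → 1 ≤ r ^ s * Nat.log 2 r := fun s r hr =>
    Nat.mul_pos (Nat.pow_pos (by omega)) (Nat.log_pos one_lt_two hr)
  induction s generalizing H with
  | zero =>
    have hapex : ∀ Y : X.Subgraph, rtd₂Sub Y + 1 ≤ 2 → Y.verts.Nonempty → ∀ m,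
        ApexHit.{u, v} (fun r => r ^ 0 * Nat.log 2 r) (copies m Y.coe) := by
      intro Y hY _ m
      have := apexHit_bot.{u, v} (X := copies m Y.coe) fun p q hpq =>
        not_adj_of_rtd₂Sub_le_one (by omega) _ _ (copies_adj.1 hpq).1
      simpa using this
    exact hit_of_apexHit 0 (hg 0) hapex H h
  | succ s ih =>
    refine hit_of_apexHit (s + 1) (hg (s + 1)) (fun Y hY hne m => ?_) H h
    -- One additional copy keeps the vertex set nonempty for `m = 0`, as `Hit.apexHit` requires.
    have hY' := (ih Y (by omega)).copies (hg s) (m + 1)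
    have : Nonempty Y.verts := hne.to_subtype
    have h2 := (hY'.apexHit (hg s)).comp (X := copies m Y.coe)
      (fun p => (p.1.castSucc, p.2)) (fun p q hpq => ?_) (fun p q hpq => ?_)
    · refine cast ?_ h2
      congr 1
      ext r
      ring
    · simp only [Prod.mk.injEq] at hpq
      exact Prod.ext (Fin.castSucc_injective _ hpq.1) hpq.2
    · rw [copies_adj] at hpq ⊢
      exact ⟨hpq.1, congrArg Fin.castSucc hpq.2⟩

end RootedTreedepth

/-! ### The Helly property from treewidth, and translation to the original definitions -/

section Treewidth

theorem pre_iff_preconnected {V : Type v} {G : SimpleGraph V} {U : Set V} :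
    Pre G U ↔ (G.induce U).Preconnected := by
  constructor
  · intro h a b
    by_contra hab
    obtain ⟨x, hx, y, hy, ⟨hxU, hxA⟩, hyA, hadj⟩ :=
      h {x | ∃ hx : x ∈ U, (G.induce U).Reachable a ⟨x, hx⟩} ⟨a, a.2, a.2, .rfl⟩
        ⟨b, b.2, fun ⟨_, hb⟩ => hab hb⟩
    have : (G.induce U).Adj ⟨x, hx⟩ ⟨y, hy⟩ := hadj
    exact hyA ⟨hy, hxA.trans this.reachable⟩
  · rintro h A ⟨a, ha, haA⟩ ⟨b, hb, hbA⟩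
    obtain ⟨p⟩ := h ⟨a, ha⟩ ⟨b, hb⟩
    obtain ⟨d, -, h1, h2⟩ := p.exists_boundary_dart (Subtype.val ⁻¹' A) haA hbA
    exact ⟨d.fst, d.fst.2, d.snd, d.snd.2, h1, h2, d.adj⟩

theorem conn_iff_connected {V : Type v} {G : SimpleGraph V} {U : Set V} :
    Conn G U ↔ (G.induce U).Connected := by
  rw [SimpleGraph.connected_iff, ← pre_iff_preconnected, Set.nonempty_coe_sort, and_comm, Conn]

theorem conn_of_subgraph_connected {V : Type v} {G : SimpleGraph V} {H : G.Subgraph}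
    (h : H.Connected) : Conn G H.verts :=
  conn_iff_connected.2 (SimpleGraph.Connected.mono
    (fun _ _ hxy => H.adj_sub hxy) h.coe)

theorem Pre.exists_walk {V : Type v} {G : SimpleGraph V} {U : Set V} (hU : Pre G U) {a b : V}
    (ha : a ∈ U) (hb : b ∈ U) : ∃ p : G.Walk a b, ∀ x ∈ p.support, x ∈ U := by
  by_contra hno
  obtain ⟨x, hx, y, hy, ⟨p, hp⟩, hyA, hadj⟩ :=
    hU {x | ∃ p : G.Walk a x, ∀ x ∈ p.support, x ∈ U} ⟨a, ha, .nil, by simpa⟩ ⟨b, hb, hno⟩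
  refine hyA ⟨p.concat hadj, fun z hz => ?_⟩
  rw [SimpleGraph.Walk.support_concat, List.mem_append, List.mem_singleton] at hz
  rcases hz with hz | rfl
  exacts [hp z hz, hy]

/-- Pairwise intersecting subtrees of a finite tree have a common vertex. -/
theorem exists_mem_forall_of_isTree {I : Type*} [Finite I] {T : SimpleGraph I} (hT : T.IsTree)
    (𝓣 : Set (Set I)) (hc : ∀ A ∈ 𝓣, Pre T A) (hi : ∀ A ∈ 𝓣, ∀ B ∈ 𝓣, (A ∩ B).Nonempty) :
    ∃ x, ∀ A ∈ 𝓣, x ∈ A := by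
  by_contra! hcon
  have hpre : Pre T Set.univ := by
    rintro A ⟨a, -, ha⟩ ⟨b, -, hb⟩
    obtain ⟨p⟩ := hT.connected.preconnected a b
    obtain ⟨d, -, h1, h2⟩ := p.exists_boundary_dart A ha hb
    exact ⟨_, trivial, _, trivial, h1, h2, d.adj⟩
  have hex : ∀ x, ∃ C, IsComp T (Set.univ \ {x}) C ∧ ∃ A ∈ 𝓣, A ⊆ C := by
    intro x
    obtain ⟨A, hA, hxA⟩ := hcon x
    obtain ⟨C, hC, hAC⟩ := (hc A hA).exists_isComp (U := Set.univ \ {x})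
      (fun y hy => ⟨trivial, fun h => hxA (h ▸ hy)⟩) ((hi A hA A hA).mono Set.inter_subset_left)
    exact ⟨C, hC, A, hA, hAC⟩
  choose C hC A hA hAC using hex
  have : Nonempty I := hT.connected.nonempty
  -- If no node is common, every node `x` has a component `C x` of the tree minus `x` that contains
  -- a member. For `C x` of minimum size and a neighbor `y` of `x` in it, `C y` must point back to
  -- `x`, since otherwise it would be a proper subset of `C x`.
  obtain ⟨x, hx⟩ := Finite.exists_min fun x => (C x).ncard
  obtain ⟨y, hy, z, rfl, hadj⟩ :=
    (hC x).touch_of_pre hpre (Set.subset_univ _) (Set.singleton_nonempty x)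
  have hxy : z ∈ C y := by
    by_contra hz
    have hyC : y ∉ C y := fun h => ((hC y).sub h).2 rfl
    have hsub : {y} ∪ C y ⊆ C z := by
      refine (hC z).subset_of_inter ((pre_singleton y).union_of_touch (hC y).conn.2
        ((hC y).touch_of_pre hpre (Set.subset_univ _) (Set.singleton_nonempty y)).symm) ?_
        ⟨y, Or.inl rfl, hy⟩
      rintro w (rfl | hw)
      · exact (hC z).sub hy
      · exact ⟨trivial, fun h => hz (h ▸ hw)⟩
    refine (Nat.lt_of_lt_of_le (Set.ncard_lt_ncard ⟨Set.subset_union_right.trans hsub, fun h =>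
      hyC (h hy)⟩ (Set.toFinite _)) (hx y)).false
  -- A common node of the two members yields a walk from `z` to `y` whose first half avoids `y` and
  -- whose second half avoids `z`. It does not use the edge `zy`, which is a bridge.
  obtain ⟨w, hwz, hwy⟩ := hi _ (hA z) _ (hA y)
  obtain ⟨p, hp⟩ := (hC y).conn.2.exists_walk hxy (hAC y hwy)
  obtain ⟨q, hq⟩ := (hC z).conn.2.exists_walk (hAC z hwz) hy
  have hb := SimpleGraph.isAcyclic_iff_forall_adj_isBridge.1 hT.isAcyclic hadj.symm
  have hmem := SimpleGraph.isBridge_iff_forall_walk_mem_edges.1 hb (p.append q)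
  rw [SimpleGraph.Walk.edges_append, List.mem_append] at hmem
  rcases hmem with h | h
  · exact ((hC y).sub (hp _ (p.snd_mem_support_of_mem_edges h))).2 rfl
  · exact ((hC z).sub (hq _ (q.fst_mem_support_of_mem_edges h))).2 rfl

/-- The nodes whose bags meet a connected set form a subtree, and intersecting sets give
intersecting subtrees. A node common to all of them has a bag that is the transversal. -/
theorem TreeDecomposition.helly {V : Type v} [Finite V] {G : SimpleGraph V} {I : Type} [Finite I]
    (D : TreeDecomposition G I) {k : ℕ} (hk : ∀ x, (D.bag x).ncard ≤ k) : Helly G k := by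
  intro 𝓑 hc hi
  have hS : ∀ u, Conn D.tree {x | u ∈ D.bag x} := fun u => conn_iff_connected.2 (D.connected_bags u)
  obtain ⟨x, hx⟩ := exists_mem_forall_of_isTree D.isTree
    ((fun B => {x | (B ∩ D.bag x).Nonempty}) '' 𝓑) (by
      rintro _ ⟨B, hB, rfl⟩ A ⟨a, ⟨u, hu, hua⟩, haA⟩ ⟨b, ⟨w, hw, hwb⟩, hbA⟩
      by_contra hcon
      have hone : ∀ u ∈ B, ∀ x ∈ {x | u ∈ D.bag x}, ∀ y ∈ {x | u ∈ D.bag x}, x ∈ A → y ∈ A := by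
        intro u hu x hx y hy hxA
        by_contra hyA
        obtain ⟨p, hp, q, hq, h1, h2, hadj⟩ := (hS u).2 A ⟨x, hx, hxA⟩ ⟨y, hy, hyA⟩
        exact hcon ⟨p, ⟨u, hu, hp⟩, q, ⟨u, hu, hq⟩, h1, h2, hadj⟩
      obtain ⟨p, hp, q, hq, hpA, hqA, hadj⟩ := (hc B hB).2
        {u | ∀ x ∈ {x | u ∈ D.bag x}, x ∈ A} ⟨u, hu, fun x hx => hone u hu a hua x hx haA⟩
        ⟨w, hw, fun h => hbA (h b hwb)⟩
      obtain ⟨x, hpx, hqx⟩ := D.edge_in_bag p q hadj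
      exact hqA fun y hy => hone q hq x hqx y hy (hpA x hpx)) (by
      rintro _ ⟨B, hB, rfl⟩ _ ⟨B', hB', rfl⟩
      obtain ⟨u, hu, hu'⟩ := hi B hB B' hB'
      obtain ⟨x, hx⟩ := (hS u).1
      exact ⟨x, ⟨u, hu, hx⟩, ⟨u, hu', hx⟩⟩)
  exact ⟨D.bag x, hk x, fun B hB => hx _ ⟨B, hB, rfl⟩⟩

theorem TreeDecomposition.neg_one_le_width {V : Type v} {G : SimpleGraph V} {I : Type}
    (D : TreeDecomposition G I) : -1 ≤ D.width := by
  unfold TreeDecomposition.width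
  omega

theorem exists_width_eq_treewidth {V : Type v} [Finite V] (G : SimpleGraph V) :
    ∃ (I : Type) (_ : Finite I) (D : TreeDecomposition G I), D.width = treewidth G := by
  refine Int.csInf_mem (s := {w : ℤ | ∃ (I : Type) (_ : Finite I)
    (D : TreeDecomposition G I), D.width = w}) ?_ ⟨-1, ?_⟩
  · refine ⟨_, Unit, inferInstance, ⟨⊥, SimpleGraph.IsTree.of_subsingleton, fun _ => Set.univ,
      fun u => ?_, fun u v _ => ⟨(), trivial, trivial⟩⟩, rfl⟩
    refine conn_iff_connected.1 ⟨⟨(), trivial⟩, ?_⟩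
    rintro A ⟨a, -, ha⟩ ⟨b, -, hb⟩
    exact (hb ha).elim
  · rintro w ⟨I, hI, D, rfl⟩
    exact D.neg_one_le_width

theorem helly_of_treewidth_lt {V : Type v} [Finite V] {G : SimpleGraph V} {k : ℤ}
    (h : treewidth G < k) : Helly G k.toNat := by
  obtain ⟨I, hI, D, hD⟩ := exists_width_eq_treewidth G
  refine D.helly fun x => ?_
  have hle : (D.bag x).ncard ≤ ⨆ x, (D.bag x).ncard :=
    le_ciSup (f := fun x => (D.bag x).ncard) (Set.finite_range _).bddAbove x
  rw [← hD, TreeDecomposition.width] at h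
  omega

/-- Breaking the ties of the ranking by an enumeration of the vertices gives a linear order, and
this can only shrink the weakly reachable sets. -/
theorem WC.wcol_le {V : Type v} [Finite V] {G : SimpleGraph V} {r n : ℕ} {S : Set V}
    (h : WC G r Set.univ S n) : wcol G r S ≤ n := by
  obtain ⟨σ, hσ⟩ := h
  obtain ⟨N, ⟨e⟩⟩ := Finite.exists_equiv_fin V
  let f : S → ℕ ×ₗ Fin N := fun v => toLex (σ v, e v)
  have hf : Function.Injective f := fun v w hvw => by
    have : (σ v, e v) = (σ w, e w) := toLex.injective hvw
    exact Subtype.ext (e.injective (congrArg Prod.snd this))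
  refine (ciInf_le (OrderBot.bddBelow _) (LinearOrder.lift' f hf)).trans ?_
  refine ciSup_le' fun u => ?_
  refine (Set.ncard_le_ncard ?_ (Set.toFinite _)).trans (hσ u trivial)
  rintro v ⟨hv, p, -, hpr, hmin⟩
  refine ⟨hv, p, hpr, fun _ _ => trivial, fun x hx hxS => ?_⟩
  have h : f ⟨v, hv⟩ ≤ f ⟨x, hxS⟩ := hmin x hxS hx
  rw [Prod.Lex.toLex_le_toLex] at h
  rcases h with h | h
  exacts [h.le, h.1.le]

/-- `N(K)` is contained in the union of the two hubs, and each hub lies in one component of `G - K`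
or is empty. -/
theorem encard_touchedComponents_le {V : Type v} {G : SimpleGraph V} {C K : Set V}
    (hC : IsComp G Set.univ C) (hK : K ⊆ C) (h : Hub G C K 2) :
    (touchedComponents G K).encard ≤ 2 := by
  obtain ⟨P, Q, hP, hQ, hPQ⟩ := h.pair
  have hnb : nbhd G K ⊆ P ∪ Q := by
    rintro x ⟨hx, hxK⟩
    obtain ⟨y, hy, hadj⟩ := Set.mem_iUnion₂.1 hx
    rw [hPQ]
    exact ⟨hC.closed y (hK hy) x trivial hadj, hxK⟩
  -- all components met by a preconnected set are equal
  have hone : ∀ R : Set V, Pre G R → R ⊆ Kᶜ →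
      {D : (G.induce Kᶜ).ConnectedComponent | (R ∩ componentVerts D).Nonempty}.Subsingleton := by
    rintro R hR hRK D ⟨x, hxR, ⟨x', hx', rfl⟩⟩ E ⟨y, hyR, ⟨y', hy', rfl⟩⟩
    obtain ⟨p⟩ := pre_iff_preconnected.1 hR ⟨x', hxR⟩ ⟨y', hyR⟩
    have hreach : (G.induce Kᶜ).Reachable x' y' :=
      ⟨p.map (SimpleGraph.induceHomOfLE G hRK).toHom⟩
    have h1 : (G.induce Kᶜ).connectedComponentMk x' = D := hx'
    have h2 : (G.induce Kᶜ).connectedComponentMk y' = E := hy'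
    rw [← h1, ← h2]
    exact SimpleGraph.ConnectedComponent.sound hreach
  have hPK : P ⊆ Kᶜ := fun x hx => (hPQ.subset (Or.inl hx)).2
  have hQK : Q ⊆ Kᶜ := fun x hx => (hPQ.subset (Or.inr hx)).2
  have hsub : touchedComponents G K ⊆
      {D : (G.induce Kᶜ).ConnectedComponent | (P ∩ componentVerts D).Nonempty} ∪
      {D : (G.induce Kᶜ).ConnectedComponent | (Q ∩ componentVerts D).Nonempty} := by
    rintro D ⟨x, hx, hxD⟩
    rcases hnb hx with h | h
    exacts [Or.inl ⟨x, h, hxD⟩, Or.inr ⟨x, h, hxD⟩]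
  refine (Set.encard_le_encard hsub).trans ((Set.encard_union_le _ _).trans ?_)
  rw [← one_add_one_eq_two]
  exact add_le_add (Set.encard_le_one_iff_subsingleton.2 (hone P hP hPK))
    (Set.encard_le_one_iff_subsingleton.2 (hone Q hQ hQK))

theorem isComp_componentVerts {V : Type v} {G : SimpleGraph V} {U : Set V}
    (C : (G.induce U).ConnectedComponent) : IsComp G U (componentVerts C) := by
  have hsub : componentVerts C ⊆ U := by
    rintro _ ⟨x, -, rfl⟩
    exact x.2
  refine ⟨hsub, ⟨?_, ?_⟩, ?_⟩
  · obtain ⟨x, hx⟩ := C.nonempty_supp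
    exact ⟨x, x, hx, rfl⟩
  · rintro A ⟨_, ⟨a, ha, rfl⟩, haA⟩ ⟨_, ⟨b, hb, rfl⟩, hbA⟩
    have ha' : (G.induce U).connectedComponentMk a = C := ha
    have hb' : (G.induce U).connectedComponentMk b = C := hb
    obtain ⟨p⟩ := SimpleGraph.ConnectedComponent.exact (ha'.trans hb'.symm)
    obtain ⟨d, hd, h1, h2⟩ := p.exists_boundary_dart (Subtype.val ⁻¹' A) haA hbA
    classical
    have hmem : ∀ x ∈ p.support, x ∈ C.supp := by
      intro x hx
      have h1 : (G.induce U).connectedComponentMk a = (G.induce U).connectedComponentMk x :=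
        SimpleGraph.ConnectedComponent.sound ⟨p.takeUntil x hx⟩
      exact h1.symm.trans ha'
    exact ⟨d.fst, ⟨_, hmem _ (p.dart_fst_mem_support_of_mem_darts hd), rfl⟩, d.snd,
      ⟨_, hmem _ (p.dart_snd_mem_support_of_mem_darts hd), rfl⟩, h1, h2, d.adj⟩
  · rintro _ ⟨x, hx, rfl⟩ y hy hadj
    have hadj' : (G.induce U).Adj x ⟨y, hy⟩ := hadj
    refine ⟨⟨y, hy⟩, ?_, rfl⟩
    have hx' : (G.induce U).connectedComponentMk x = C := hx
    exact (SimpleGraph.ConnectedComponent.sound hadj'.symm.reachable).trans hx'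

/-- For disconnected graphs, solve the problem in each component. -/
theorem exists_solution {V : Type v} [Finite V] {G : SimpleGraph V} {F : Set V → Prop} {b : ℕ → ℕ}
    (h : ∀ C, IsComp G Set.univ C → Solvable G C C F 2 b) :
    ∃ S : Set V, (∀ K, Conn G K → F K → (K ∩ S).Nonempty) ∧
      (∀ C : (G.induce Sᶜ).ConnectedComponent,
        (touchedComponents G (componentVerts C)).encard ≤ 2) ∧
      ∀ r, 2 ≤ r → wcol G r S ≤ b r := by
  choose! S hS hF hH hW using h
  let T : Set V := ⋃ C : {C // IsComp G Set.univ C}, S C.1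
  have hTC : ∀ C, IsComp G Set.univ C → T ∩ C = S C := by
    intro C hC
    ext x
    constructor
    · rintro ⟨hx, hxC⟩
      obtain ⟨D, hD⟩ := Set.mem_iUnion.1 hx
      rwa [← D.2.eq_of_inter hC ⟨x, hS D.1 D.2 hD, hxC⟩]
    · exact fun hx => ⟨Set.mem_iUnion.2 ⟨⟨C, hC⟩, hx⟩, hS C hC hx⟩
  have hin : ∀ K, Conn G K → Disjoint K T → ∃ C, IsComp G Set.univ C ∧ K ⊆ C \ S C := by
    intro K hK hd
    obtain ⟨C, hC, hKC⟩ := hK.2.exists_isComp (Set.subset_univ _) hK.1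
    exact ⟨C, hC, fun x hx => ⟨hKC hx, fun h =>
      hd.le_bot ⟨hx, ((hTC C hC).symm.subset h).1⟩⟩⟩
  refine ⟨T, fun K hK hFK => ?_, fun D => ?_, fun r hr => WC.wcol_le ?_⟩
  · by_contra hno
    obtain ⟨C, hC, hKC⟩ := hin K hK (by
      rwa [← Set.not_disjoint_iff_nonempty_inter, not_not] at hno)
    exact hF C hC K hKC hK hFK
  · have hD := isComp_componentVerts D
    obtain ⟨C, hC, hDC⟩ := hin _ hD.conn (Set.disjoint_left.2 hD.sub)
    refine encard_touchedComponents_le hC (hDC.trans Set.sdiff_subset) (hH C hC _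
      ⟨hDC, hD.conn, fun x hx y hy hadj => hD.closed x hx y (fun hyT => hy.2 ?_) hadj⟩)
    exact (hTC C hC).subset ⟨hyT, hy.1⟩
  · have := WC.compose (S₁ := ∅) (T := T) (G := G) (r := r) (U := Set.univ) (n₁ := 0) (n₂ := b r)
      (by simp) (WC.of_ncard_le (by simp)) fun C hC => by
        rw [Set.sdiff_empty] at hC
        rw [hTC C hC]
        exact hW C hC r hr
    simpa using this

end Treewidth

end WeakColoring

theorem mainTheorem8 (t : ℕ) (ht : 2 ≤ t) {W : Type*} [Finite W] (X : SimpleGraph W)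
    (hX : WeakColoring.rtd₂ X ≤ t) :
    ∃ c : ℤ, ∀ (k : ℤ) (V : Type*) [Finite V] (G : SimpleGraph V),
      WeakColoring.treewidth G < k →
      ∀ F : Set G.Subgraph, (∀ H ∈ F, H.Connected) →
        (¬ ∃ B : W → Set V, WeakColoring.IsRichModel X G F B) →
        ∃ S : Set V,
          (∀ H ∈ F, (H.verts ∩ S).Nonempty) ∧
          (∀ C : (G.induce Sᶜ).ConnectedComponent,
            (WeakColoring.touchedComponents G (WeakColoring.componentVerts C)).encard ≤ 2) ∧
          ∀ r : ℕ, 2 ≤ r →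
            (WeakColoring.wcol G r S : ℝ) ≤ (c : ℝ) * k * (r : ℝ) ^ (t - 2) * Real.log r := by
  obtain ⟨s, rfl⟩ := Nat.exists_eq_add_of_le' ht
  obtain ⟨c, hc⟩ := (WeakColoring.hit_of_rtd₂Sub_le s (⊤ : X.Subgraph) hX).comp (X := X)
    (fun x => ⟨x, trivial⟩) (fun x y h => congrArg Subtype.val h) fun x y h => h
  -- The factor `2` changes the logarithm: `Nat.log 2 r ≤ 2 * Real.log r`, because `log 2 > 1 / 2`.
  refine ⟨2 * c, fun k V _ G hk F hF hno => ?_⟩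
  -- Treewidth is at least `-1`, so replacing `k` by `k.toNat` loses nothing.
  have hk0 : 0 ≤ k := by
    obtain ⟨I, _, D, hD⟩ := WeakColoring.exists_width_eq_treewidth G
    have := D.neg_one_le_width
    omega
  have hrich : ∀ C B, WeakColoring.Model X G (fun K => ∃ H ∈ F, H.verts ⊆ K) C B →
      WeakColoring.IsRichModel X G F B := by
    refine fun C B hB => ⟨⟨hB.disj, fun x => WeakColoring.conn_iff_connected.1 (hB.conn x),
      hB.edge⟩, fun x => ?_⟩
    obtain ⟨H, hH, hHB⟩ := hB.rich x
    exact ⟨H, hH, hHB, fun a b hab => ⟨hHB hab.fst_mem, hHB hab.snd_mem, hab.adj_sub⟩⟩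
  obtain ⟨S, hS, hSC, hSW⟩ := WeakColoring.exists_solution (G := G)
    (F := fun K => ∃ H ∈ F, H.verts ⊆ K) (b := fun r => c * k.toNat * (r ^ s * Nat.log 2 r))
    fun C hC => hc V G k.toNat (WeakColoring.helly_of_treewidth_lt hk) C hC.conn _
      (fun A B hAB ⟨H, hH, hHA⟩ => ⟨H, hH, hHA.trans hAB⟩) fun ⟨B, hB⟩ => hno ⟨B, hrich C B hB⟩
  refine ⟨S, fun H hH => hS _ (WeakColoring.conn_of_subgraph_connected (hF H hH))
    ⟨H, hH, subset_rfl⟩, hSC, fun r hr => ?_⟩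
  have h1 : (WeakColoring.wcol G r S : ℝ) ≤
      (c : ℝ) * (k.toNat : ℝ) * ((r : ℝ) ^ s * (Nat.log 2 r : ℝ)) := by
    exact_mod_cast hSW r hr
  have h2 : ((k.toNat : ℕ) : ℝ) = (k : ℝ) := by
    exact_mod_cast Int.toNat_of_nonneg hk0
  have h3 : (Nat.log 2 r : ℝ) ≤ 2 * Real.log r := by
    have h4 : ((2 : ℕ) : ℝ) ^ Nat.log 2 r ≤ r := by
      exact_mod_cast Nat.pow_log_le_self 2 (by omega)
    have h5 := Real.log_le_log (by positivity) h4
    rw [Real.log_pow] at h5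
    have h6 := Real.log_two_gt_d9
    push_cast at h5
    have h7 : (0 : ℝ) ≤ (Nat.log 2 r : ℝ) := Nat.cast_nonneg _
    nlinarith
  rw [h2] at h1
  have hk0' : (0 : ℝ) ≤ k := by exact_mod_cast hk0
  calc (WeakColoring.wcol G r S : ℝ) ≤ (c : ℝ) * k * ((r : ℝ) ^ s * (Nat.log 2 r : ℝ)) := h1
    _ ≤ (c : ℝ) * k * ((r : ℝ) ^ s * (2 * Real.log r)) := by gcongr
    _ = ((2 * c : ℤ) : ℝ) * k * (r : ℝ) ^ (s + 2 - 2) * Real.log r := by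
      rw [Nat.add_sub_cancel]
      push_cast
      ring
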